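/- **Setting.** Fix $k,r$ and consider samples indexed by $n\to\infty$ with dimensions $a,b,T\to\infty$ (the index $n$ is suppressed; all data may depend on $n$). Let $\mathbf Y_t=\mathbf R\mathbf F_t\mathbf C^\top+\mathbf E_t\in\mathbb R^{a\times b}$, $t=1,\dots,T$, with random $\mathbf R\in\mathbb R^{a\times k}$, $\mathbf F_t\in\mathbb R^{k\times r}$, $\mathbf C\in\mathbb R^{b\times r}$, $\mathbf E_t=(e_{t,im})$; rows (as column vectors) are denoted $\mathbf R_i,\mathbf C_m$. Let $W_{t,im}\in\{0,1\}$ indicate whether $Y_{t,im}$ is observed, $Q_{ij}=\{(t,m):W_{t,im}=W_{t,jm}=1\}$, and $$\widehat M_{ij}=\frac1{a|Q_{ij}|}\sum_{(t,m)\in Q_{ij}}Y_{t,im}Y_{t,jm}.$$ Let $V$ be the diagonal matrix of the $k$ largest eigenvalues of $\widehat M$ in decreasing order, and let $\widehat{\mathbf R}\in\mathbb R^{a\times k}$ be random with $\widehat M\widehat{\mathbf R}=\widehat{\mathbf R}V$, $\frac1a\widehat{\mathbf R}^\top\widehat{\mathbf R}=I$. Put $$S=\frac1{bT}\sum_t\mathbf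 F_t\mathbf C^\top\mathbf C\mathbf F_t^\top,\quad S_{ij}=\frac1{|Q_{ij}|}\sum_{(t,m)\in Q_{ij}}\mathbf F_t\mathbf C_m\mathbf C_m^\top\mathbf F_t^\top,\quad \mathbf H_R=\tfrac1a\,S\,\mathbf R^\top\widehat{\mathbf R}V^{-1}.$$ **Assumptions.** There are constants $M<\infty$, $q>0$ such that, uniformly in all indices and in $n$: 1. For every $t$, $W_t$ is independent of $(\mathbf F_t,\mathbf E_t)$, and $\mathbf R,\mathbf C,\mathbf F_t,\mathbf E_t$ are independent. With probability tending to one, $|Q_{ij}|\ge q\,bT$ for all $i,j$. 2. $\|\mathbf R_i\|\le M$ a.s.; $\frac1a\mathbf R^\top\mathbf R\to_p\Sigma_R$; $\mathbb E\|\mathbf F_t\|^4\le M$; $\mathbb E\|\mathbf F_t\mathbf C_m\|^4\le M$; $\mathbb E\|\sqrt{bT}(S-\Sigma_{FC})\|^2\le M$; $\mathbb E\|\sqrt{|Q_{ij}|}(S_{ij}-\Sigma_{FC})\|^2\le M$; $\Sigma_R,\Sigma_{FC}$ are positive definite. 3. $\mathbb E e_{t,im}=0$; $\mathbb E|e_{t,im}|^8\le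 M$; $|\mathbb E e_{t,im}e_{s,im}|\le\gamma_{ts}$ with $\sum_s\gamma_{ts}\le M$; $|\mathbb E e_{t,im}e_{t,jm}|\le\tau_{ij}$ with $\sum_i\tau_{ij}\le M$; $\mathbb E\big|\,|Q_{ij}|^{-1/2}\sum_{(t,m)\in Q_{ij}}(e_{t,im}e_{t,jm}-\mathbb E e_{t,im}e_{t,jm})\big|^4\le M$. 4. $\mathbb E\big\||Q_{ij}|^{-1/2}\sum_{(t,m)\in Q_{ij}}\mathbf F_t\mathbf C_me_{t,lm}\big\|^4\le M$ for $l=i$ and $l=j$. 5. $\Sigma_{FC}^{1/2}\Sigma_R\Sigma_{FC}^{1/2}$ has distinct eigenvalues $d_1>\dots>d_k$. Put $D=\mathrm{diag}(d_1,\dots,d_k)$, let $\gamma$ be an orthogonal matrix whose columns are corresponding eigenvectors, and $Q=D^{1/2}\gamma^\top\Sigma_{FC}^{-1/2}$. The signs of the columns of $\widehat{\mathbf R}$ are chosen so that $\widehat{\mathbf R}^\top\mathbf RQ^{-1}$ has nonnegative diagonal. 6. For the row $j$ under consideration (which may depend on $n$): $\mathbb E\big\|\sqrt{bT/a}\sum_i|Q_{ij}|^{-1}\sum_{(t,m)\in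 Q_{ij}}\mathbf R_i(e_{t,im}e_{t,jm}-\mathbb E e_{t,im}e_{t,jm})\big\|^2\le M$, $\ \mathbb E\big\|\sqrt{bT/a}\sum_i|Q_{ij}|^{-1}\sum_{(t,m)\in Q_{ij}}\mathbf R_i\mathbf C_m^\top\mathbf F_t^\top e_{t,im}\big\|^2\le M$, and the pair $$\Big(\tfrac{\sqrt{bT}}a\sum_i\mathbf R_i\mathbf R_i^\top\tfrac1{|Q_{ij}|}\sum_{(t,m)\in Q_{ij}}\mathbf F_t\mathbf C_me_{t,jm},\ \ \tfrac{\sqrt{bT}}a\sum_i\mathbf R_i\mathbf R_i^\top(S_{ij}-S)\mathbf R_j\Big)$$ converges in distribution to a pair of independent vectors with laws $N(0,\Gamma^{obs}_{R_j})$ and $N(0,\Gamma^{miss}_{R_j})$. **Theorem 3.** Under 1–5, $V\to_pD$ and $\mathbf H_R\to_pQ^{-1}$. If in addition 6 holds and $\sqrt{bT}/a\to0$, then $$\sqrt{bT}\,(\widehat{\mathbf R}_j-\mathbf H_R^\top\mathbf R_j)\xrightarrow{\mathcal D}N\Big(0,\;D^{-1}(Q^{-1})^\top\big[\Gamma^{obs}_{R_j}+\Gamma^{miss}_{R_j}\big]Q^{-1}D^{-1}\Big).$$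 The same holds for the column loadings, i.e. for the transposed model $\mathbf Y_t^\top=\mathbf C\mathbf F_t^\top\mathbf R^\top+\mathbf E_t^\top$ under the transposed assumptions: with $E,P$ the analogues of $D,Q$ built from $\Sigma_C,\Sigma_{FR}$, the eigenvalue matrix converges to $E$ and $\mathbf H_C\to_pP^{-1}$ in probability, and if $\sqrt{aT}/b\to0$ then $$\sqrt{aT}\,(\widehat{\mathbf C}_j-\mathbf H_C^\top\mathbf C_j)\xrightarrow{\mathcal D}N\Big(0,\;E^{-1}(P^{-1})^\top\big[\Gamma^{obs}_{C_j}+\Gamma^{miss}_{C_j}\big]P^{-1}E^{-1}\Big).$$ -/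

import Mathlib

open MeasureTheory ProbabilityTheory Filter Topology
open scoped Matrix Matrix.Norms.L2Operator ENNReal NNReal

/-- One sample of the partially observed matrix factor model `Y t = R * F t * Cᵀ + E t`,
`t = 1, …, T`, with `Y t` of size `a × b` and `F t` of size `k × r`; `W t i m = true` means that
the entry `(i, m)` of `Y t` is observed.  Rows of `R` and `C` are the loading vectors. -/
structure Panel (Ω : Type*) (k r : ℕ) where
  a : ℕ
  b : ℕ
  T : ℕ
  R : Ω → Matrix (Fin a) (Fin k) ℝ
  C : Ω → Matrix (Fin b) (Fin r) ℝ
  F : Fin T → Ω → Matrix (Fin k) (Fin r) ℝ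
  E : Fin T → Ω → Matrix (Fin a) (Fin b) ℝ
  W : Fin T → Ω → Matrix (Fin a) (Fin b) Bool

namespace Panel

variable {Ω : Type*} {k r : ℕ}

/-- The transposed model `(Y t)ᵀ = C * (F t)ᵀ * Rᵀ + (E t)ᵀ`.  Every column object of the model is
the corresponding row object of the transposed model. -/
def transpose (X : Panel Ω k r) : Panel Ω r k where
  a := X.b
  b := X.a
  T := X.T
  R := X.C
  C := X.R
  F := fun t ω => (X.F t ω)ᵀ
  E := fun t ω => (X.E t ω)ᵀ
  W := fun t ω => (X.W t ω)ᵀ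

/-- The data matrices. -/
def Y (X : Panel Ω k r) (t : Fin X.T) (ω : Ω) : Matrix (Fin X.a) (Fin X.b) ℝ :=
  X.R ω * X.F t ω * (X.C ω)ᵀ + X.E t ω

/-- `Q_{R,ij}`: the pairs `(t, m)` for which both `Y t i m` and `Y t j m` are observed. -/
def Q (X : Panel Ω k r) (i j : Fin X.a) (ω : Ω) : Finset (Fin X.T × Fin X.b) :=
  Finset.univ.filter fun p => X.W p.1 ω i p.2 = true ∧ X.W p.1 ω j p.2 = true

/-- The cardinality `|Q_{R,ij}|`, as a real number. -/
noncomputable def N (X : Panel Ω k r) (i j : Fin X.a) (ω : Ω) : ℝ := ((X.Q i j ω).card : ℝ)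

/-- The adjusted covariance matrix `M̂_R`, computed from the observed entries. -/
noncomputable def Mhat (X : Panel Ω k r) (ω : Ω) : Matrix (Fin X.a) (Fin X.a) ℝ :=
  Matrix.of fun i j =>
    (1 / (X.a : ℝ)) * (1 / X.N i j ω) * ∑ p ∈ X.Q i j ω, X.Y p.1 ω i p.2 * X.Y p.1 ω j p.2

theorem Mhat_isHermitian (X : Panel Ω k r) (ω : Ω) : (X.Mhat ω).IsHermitian := by
  have hQ : ∀ i j, X.Q i j ω = X.Q j i ω := fun i j => by
    simp only [Q, and_comm]
  ext i j
  simp only [Mhat, N, Matrix.conjTranspose_apply, Matrix.of_apply, star_trivial]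
  rw [hQ j i]
  simp only [mul_comm]

/-- The diagonal of `V_R`: the `k` largest eigenvalues of `M̂_R`, with multiplicity, in decreasing
order (`eigenvalues₀` is the decreasing list of all eigenvalues). -/
noncomputable def eigval (X : Panel Ω k r) (ω : Ω) (l : Fin k) : ℝ :=
  if h : (l : ℕ) < Fintype.card (Fin X.a) then (X.Mhat_isHermitian ω).eigenvalues₀ ⟨l, h⟩ else 0

/-- `Rhat` is the matrix of `√a` times orthonormal eigenvectors of `M̂_R` for its `k` largest
eigenvalues. -/
def IsEstimator (X : Panel Ω k r) (ω : Ω) (Rhat : Matrix (Fin X.a) (Fin k) ℝ) : Prop :=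
  (1 / (X.a : ℝ)) • (Rhatᵀ * Rhat) = 1 ∧
    X.Mhat ω * Rhat = Rhat * Matrix.diagonal (X.eigval ω)

/-- `∑_t F_t Cᵀ C F_tᵀ / (b T)`. -/
noncomputable def S (X : Panel Ω k r) (ω : Ω) : Matrix (Fin k) (Fin k) ℝ :=
  (1 / ((X.b : ℝ) * X.T)) • ∑ t, X.F t ω * (X.C ω)ᵀ * X.C ω * (X.F t ω)ᵀ

/-- The rotation matrix
`H_R = (a b T)⁻¹ (∑_t F_t Cᵀ C F_tᵀ) Rᵀ Rhat V_R⁻¹`. -/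
noncomputable def H (X : Panel Ω k r) (ω : Ω) (Rhat : Matrix (Fin X.a) (Fin k) ℝ) :
    Matrix (Fin k) (Fin k) ℝ :=
  (1 / ((X.a : ℝ) * X.b * X.T)) •
    ((∑ t, X.F t ω * (X.C ω)ᵀ * X.C ω * (X.F t ω)ᵀ) * (X.R ω)ᵀ * Rhat *
      (Matrix.diagonal (X.eigval ω))⁻¹)

/-- The estimation error `Rhat_j - H_Rᵀ R_j` of the `j`-th loading vector. -/
noncomputable def err (X : Panel Ω k r) (ω : Ω) (Rhat : Matrix (Fin X.a) (Fin k) ℝ)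
    (j : Fin X.a) : EuclideanSpace ℝ (Fin k) :=
  WithLp.toLp 2 (Rhat j - (X.H ω Rhat)ᵀ *ᵥ X.R ω j)

/-- The vector `F_t C_m`. -/
def FC (X : Panel Ω k r) (ω : Ω) (t : Fin X.T) (m : Fin X.b) : Fin k → ℝ :=
  X.F t ω *ᵥ X.C ω m

/-- `∑_{(t,m) ∈ Q_{R,ij}} F_t C_m e_{t,lm}`. -/
noncomputable def factorErr (X : Panel Ω k r) (ω : Ω) (i j l : Fin X.a) : Fin k → ℝ :=
  ∑ p ∈ X.Q i j ω, X.E p.1 ω l p.2 • X.FC ω p.1 p.2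

/-- `|Q_{R,ij}|⁻¹ ∑_{(t,m) ∈ Q_{R,ij}} F_t C_m C_mᵀ F_tᵀ`. -/
noncomputable def SQ (X : Panel Ω k r) (ω : Ω) (i j : Fin X.a) : Matrix (Fin k) (Fin k) ℝ :=
  (1 / X.N i j ω) •
    ∑ p ∈ X.Q i j ω, Matrix.vecMulVec (X.FC ω p.1 p.2) (X.FC ω p.1 p.2)

/-- `∑_{(t,m) ∈ Q_{R,ij}} (e_{t,im} e_{t,jm} - 𝔼[e_{t,im} e_{t,jm}])`. -/
noncomputable def centeredErr [MeasurableSpace Ω] (X : Panel Ω k r) (μ : Measure Ω)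
    (ω : Ω) (i j : Fin X.a) : ℝ :=
  ∑ p ∈ X.Q i j ω,
    (X.E p.1 ω i p.2 * X.E p.1 ω j p.2 - ∫ ω', X.E p.1 ω' i p.2 * X.E p.1 ω' j p.2 ∂μ)

/-- The leading noise term
`(√(bT) / a) ∑_i R_i R_iᵀ |Q_{R,ij}|⁻¹ ∑_{(t,m) ∈ Q_{R,ij}} F_t C_m e_{t,jm}`. -/
noncomputable def obsTerm (X : Panel Ω k r) (ω : Ω) (j : Fin X.a) : EuclideanSpace ℝ (Fin k) :=
  WithLp.toLp 2 ((√((X.b : ℝ) * X.T) / X.a) •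
    ∑ i, Matrix.vecMulVec (X.R ω i) (X.R ω i) *ᵥ ((1 / X.N i j ω) • X.factorErr ω i j j))

/-- The leading term due to the missing entries
`(√(bT) / a) ∑_i R_i R_iᵀ (|Q_{R,ij}|⁻¹ ∑_{(t,m) ∈ Q_{R,ij}} F_t C_m C_mᵀ F_tᵀ
  - (b T)⁻¹ ∑_{t,m} F_t C_m C_mᵀ F_tᵀ) R_j`. -/
noncomputable def missTerm (X : Panel Ω k r) (ω : Ω) (j : Fin X.a) : EuclideanSpace ℝ (Fin k) :=
  WithLp.toLp 2 ((√((X.b : ℝ) * X.T) / X.a) •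
    ∑ i, (Matrix.vecMulVec (X.R ω i) (X.R ω i) * (X.SQ ω i j - X.S ω)) *ᵥ X.R ω j)

end Panel

/-- Standing assumptions on a sequence of samples: growing dimensions, measurability,
independence, and the moment and serial dependence conditions on the noise. -/
structure ModelAssumptions {Ω : Type*} [MeasurableSpace Ω] {k r : ℕ} (X : ℕ → Panel Ω k r)
    (μ : Measure Ω) (M : ℝ≥0) : Prop where
  tendsto_a : Tendsto (fun n => (X n).a) atTop atTop
  tendsto_b : Tendsto (fun n => (X n).b) atTop atTop
  tendsto_T : Tendsto (fun n => (X n).T) atTop atTop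
  measurable_R : ∀ n i l, Measurable fun ω => (X n).R ω i l
  measurable_C : ∀ n m l, Measurable fun ω => (X n).C ω m l
  measurable_F : ∀ n t l l', Measurable fun ω => (X n).F t ω l l'
  measurable_E : ∀ n t i m, Measurable fun ω => (X n).E t ω i m
  measurable_W : ∀ n t i m, Measurable fun ω => (X n).W t ω i m
  indep_W : ∀ n t, IndepFun (fun ω i m => (X n).W t ω i m)
    (fun ω => ((fun l l' => (X n).F t ω l l'), fun i m => (X n).E t ω i m)) μ
  indep_model : ∀ n t, iIndep
    ![MeasurableSpace.comap (fun ω i l => (X n).R ω i l) MeasurableSpace.pi,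
      MeasurableSpace.comap (fun ω m l => (X n).C ω m l) MeasurableSpace.pi,
      MeasurableSpace.comap (fun ω l l' => (X n).F t ω l l') MeasurableSpace.pi,
      MeasurableSpace.comap (fun ω i m => (X n).E t ω i m) MeasurableSpace.pi] μ
  moment_F : ∀ n t, ∫⁻ ω, ‖(X n).F t ω‖ₑ ^ 4 ∂μ ≤ M
  mean_E : ∀ n t i m, ∫ ω, (X n).E t ω i m ∂μ = 0
  moment_E : ∀ n t i m, ∫⁻ ω, ‖(X n).E t ω i m‖ₑ ^ 8 ∂μ ≤ M
  serial_E : ∀ n, ∃ g : Fin (X n).T → Fin (X n).T → ℝ,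
    (∀ t s i m, |∫ ω, (X n).E t ω i m * (X n).E s ω i m ∂μ| ≤ g t s) ∧
      ∀ t, ∑ s, g t s ≤ M

/-- The assumptions for the row loadings.  The column version is this one for the transposed
samples.  All bounds are uniform in the sample and in the indices. -/
structure RowAssumptions {Ω : Type*} [MeasurableSpace Ω] {k r : ℕ} (X : ℕ → Panel Ω k r)
    (μ : Measure Ω) (M : ℝ≥0) (q : ℝ) (SigR SigFC : Matrix (Fin k) (Fin k) ℝ) : Prop where
  /-- enough common observations, with probability tending to one -/
  card_Q : Tendsto (fun n => μ {ω | ∀ i j, q * ((X n).b * (X n).T) ≤ (X n).N i j ω})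
    atTop (𝓝 1)
  /-- loadings: bounded rows and a limiting second moment -/
  bound_R : ∀ n i, ∀ᵐ ω ∂μ, ‖(WithLp.toLp 2 ((X n).R ω i) : EuclideanSpace ℝ (Fin k))‖ ≤ M
  tendsto_R : TendstoInMeasure μ
    (fun n ω => (1 / ((X n).a : ℝ)) • (((X n).R ω)ᵀ * (X n).R ω)) atTop (fun _ => SigR)
  /-- factors -/
  moment_FC : ∀ n t m,
    ∫⁻ ω, ‖(WithLp.toLp 2 ((X n).FC ω t m) : EuclideanSpace ℝ (Fin k))‖ₑ ^ 4 ∂μ ≤ M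
  moment_S : ∀ n,
    ∫⁻ ω, ‖√((X n).b * (X n).T : ℝ) • ((X n).S ω - SigFC)‖ₑ ^ 2 ∂μ ≤ M
  moment_SQ : ∀ n i j,
    ∫⁻ ω, ‖√((X n).N i j ω) • ((X n).SQ ω i j - SigFC)‖ₑ ^ 2 ∂μ ≤ M
  /-- cross-sectional dependence of the noise -/
  cross_E : ∀ n, ∃ τ : Fin (X n).a → Fin (X n).a → ℝ,
    (∀ t i j m, |∫ ω, (X n).E t ω i m * (X n).E t ω j m ∂μ| ≤ τ i j) ∧
      ∀ j, ∑ i, τ i j ≤ M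
  moment_EE : ∀ n i j,
    ∫⁻ ω, ‖(1 / √((X n).N i j ω)) * (X n).centeredErr μ ω i j‖ₑ ^ 4 ∂μ ≤ M
  /-- weak dependence between the factors and the noise -/
  moment_FE_right : ∀ n i j,
    ∫⁻ ω, ‖(WithLp.toLp 2 ((1 / √((X n).N i j ω)) • (X n).factorErr ω i j j) :
      EuclideanSpace ℝ (Fin k))‖ₑ ^ 4 ∂μ ≤ M
  moment_FE_left : ∀ n i j,
    ∫⁻ ω, ‖(WithLp.toLp 2 ((1 / √((X n).N i j ω)) • (X n).factorErr ω i j i) :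
      EuclideanSpace ℝ (Fin k))‖ₑ ^ 4 ∂μ ≤ M

/-- Moment conditions and central limit theorems for the row with index `j n` in sample `n`:
the two leading terms are asymptotically normal and asymptotically independent. -/
structure RowCLT {Ω : Type*} [MeasurableSpace Ω] {k r : ℕ} (X : ℕ → Panel Ω k r)
    (μ : Measure Ω) [IsProbabilityMeasure μ] (M : ℝ≥0) (j : ∀ n, Fin (X n).a)
    (Gobs Gmiss : Matrix (Fin k) (Fin k) ℝ) : Prop where
  posSemidef_obs : Gobs.PosSemidef
  posSemidef_miss : Gmiss.PosSemidef
  moment_REE : ∀ n, ∫⁻ ω, ‖(WithLp.toLp 2 (√((X n).b * (X n).T / (X n).a : ℝ) •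
    ∑ i, ((1 / (X n).N i (j n) ω) * (X n).centeredErr μ ω i (j n)) • (X n).R ω i) :
      EuclideanSpace ℝ (Fin k))‖ₑ ^ 2 ∂μ ≤ M
  moment_RFE : ∀ n, ∫⁻ ω, ‖√((X n).b * (X n).T / (X n).a : ℝ) •
    ∑ i, (1 / (X n).N i (j n) ω) •
      Matrix.vecMulVec ((X n).R ω i) ((X n).factorErr ω i (j n) i)‖ₑ ^ 2 ∂μ ≤ M
  clt : TendstoInDistribution
    (fun n ω => ((X n).obsTerm ω (j n), (X n).missTerm ω (j n))) atTop id (fun _ => μ)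
    ((multivariateGaussian (0 : EuclideanSpace ℝ (Fin k)) Gobs).prod
      (multivariateGaussian (0 : EuclideanSpace ℝ (Fin k)) Gmiss))

/-- `d` lists the eigenvalues of `SigF^{1/2} SigL SigF^{1/2}`, assumed distinct, in decreasing
order, `γ` is an orthogonal matrix whose columns are the corresponding eigenvectors, and
`Q = D^{1/2} γᵀ SigF^{-1/2}` with `D = diag(d)`; here `S` is the positive definite square root. -/
def IsLimitRotation {k : ℕ} (SigL SigF : Matrix (Fin k) (Fin k) ℝ) (d : Fin k → ℝ)
    (Q : Matrix (Fin k) (Fin k) ℝ) : Prop :=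
  SigL.PosDef ∧ SigF.PosDef ∧ StrictAnti d ∧
    ∃ S γ : Matrix (Fin k) (Fin k) ℝ, S.PosDef ∧ S * S = SigF ∧ γᵀ * γ = 1 ∧
      S * SigL * S * γ = γ * Matrix.diagonal d ∧
      Q = Matrix.diagonal (fun l => √(d l)) * γᵀ * S⁻¹

/-- `Rhat` is a measurable choice of the principal component estimator of the row loadings, the
signs of the columns being chosen so that each column has nonnegative inner product with the
corresponding column of `R * Q⁻¹`. -/
structure IsAlignedEstimator {Ω : Type*} [MeasurableSpace Ω] {k r : ℕ} (X : ℕ → Panel Ω k r)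
    (μ : Measure Ω) (Q : Matrix (Fin k) (Fin k) ℝ)
    (Rhat : ∀ n, Ω → Matrix (Fin (X n).a) (Fin k) ℝ) : Prop where
  measurable : ∀ n i l, Measurable fun ω => Rhat n ω i l
  isEstimator : ∀ n, ∀ᵐ ω ∂μ, (X n).IsEstimator ω (Rhat n ω)
  sign : ∀ n, ∀ᵐ ω ∂μ, ∀ l, 0 ≤ ((Rhat n ω)ᵀ * ((X n).R ω * Q⁻¹)) l l

/-!
Write `X` for the residual `a M̂ - R S Rᵀ` (`Panel.resid`).  By `Panel.resid_apply` its entries are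
`R_iᵀ (S_ij - S) R_j` plus two factor–noise cross terms, the centred noise products and the noise
covariances.  On the event `|Q_ij| ≥ q b T`, `Panel.resid_sq_le` bounds `X_ij²` by
`u_ij / (b T) + 5 τ_ij²`, where `u_ij` has bounded mean and the `τ_ij` have bounded row sums.
Consequently the mean square over all entries of `X` and the mean square of a single column are of
order `1 / (b T) + 1 / a` in probability.

*Consistency.*  Let `Z = Rᵀ Rhat / a` and let `v` be the leading eigenvalues of `M̂`.  Projecting
the eigenvalue equation on `R` and on `Rhat` gives
`(RᵀR / a) S Z + E₁ = Z diag(v)` and `Zᵀ S Z + E₂ = diag(v)`, with `E₁`, `E₂` controlled by `X`.  A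
Courant–Fischer bound on the range of `R` (`Matrix.IsHermitian.le_eigenvalues₀`) keeps `v` away
from `0`.  In the limit these equations say that `γᵀ Σ_FC^{1/2} Z` has orthogonal columns that are
eigenvectors of `D`; as `D` has distinct decreasing diagonal entries and the signs are fixed, the
solution is unique (`IsLimitRotation.unique`), and compactness (`IsLimitRotation.tendsto`) turns
uniqueness into `v → d` and `Z → Σ_FC⁻¹ Q⁻¹ D`, whence `H = S Z diag(v)⁻¹ → Q⁻¹`.

*Limit distribution.*  The eigenvalue equation also reads `Rhat - R H = X Rhat diag(v)⁻¹ / a`.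
Inserting `Rhat = R H + err` on the right (`Panel.IsEstimator.err_expansion`), the part with `R H`
gives `diag(v)⁻¹ Hᵀ (obsTerm + missTerm)` up to terms that vanish because `√(bT) / a → 0`, and the
part with `err` is, by Cauchy–Schwarz, at most `√(bT)` times the order `1 / (b T) + 1 / a`.
Slutsky's theorem and the law of a linear image of a Gaussian vector conclude.

All probabilistic limits are taken along a filter `inProb μ` on `ℕ × Ω`, along which convergence to
a constant is convergence in probability, so that the deterministic calculus of limits applies.
The conditions on dimensions and measurability (`IsRegularSequence`) are symmetric under
transposition, so the column loadings are the row loadings of the transposed samples.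
-/

/-! ### Convergence in probability as convergence along a filter -/

/-- The filter on `ℕ × Ω` of the events `s` whose sections `{ω | (n, ω) ∈ s}` hold with probability
tending to one.  A function of `(n, ω)` tends to a constant along it iff it does so in
probability. -/
def inProb {Ω : Type*} [MeasurableSpace Ω] (μ : Measure Ω) : Filter (ℕ × Ω) where
  sets := {s | Tendsto (fun n => μ {ω | (n, ω) ∉ s}) atTop (𝓝 0)}
  univ_sets := by simp
  sets_of_superset := by
    intro s t hs hst
    exact tendsto_of_tendsto_of_tendsto_of_le_of_le tendsto_const_nhds hs (fun _ => zero_le)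
      (fun n => measure_mono fun ω hω h => hω (hst h))
  inter_sets := by
    intro s t hs ht
    have h := Tendsto.add hs ht
    rw [add_zero] at h
    refine tendsto_of_tendsto_of_tendsto_of_le_of_le tendsto_const_nhds h (fun _ => zero_le)
      (fun n => (measure_mono fun ω hω => ?_).trans (measure_union_le _ _))
    by_contra hc
    simp only [Set.mem_union, Set.mem_ofPred_eq, not_or, not_not] at hc
    exact hω hc

section InProb

variable {Ω : Type*} [MeasurableSpace Ω] {μ : Measure Ω}

theorem eventually_inProb {P : ℕ × Ω → Prop} :
    (∀ᶠ p in inProb μ, P p) ↔ Tendsto (fun n => μ {ω | ¬ P (n, ω)}) atTop (𝓝 0) := Iff.rfl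

theorem tendstoInMeasure_const_iff {E : Type*} [PseudoEMetricSpace E] {f : ℕ → Ω → E} {c : E} :
    TendstoInMeasure μ f atTop (fun _ => c) ↔
      Tendsto (fun p : ℕ × Ω => f p.1 p.2) (inProb μ) (𝓝 c) := by
  rw [Metric.nhds_basis_eball.tendsto_right_iff]
  simp only [TendstoInMeasure, eventually_inProb, Metric.mem_eball, not_lt]

theorem eventually_inProb_of_ae {P : ℕ → Ω → Prop} (h : ∀ n, ∀ᵐ ω ∂μ, P n ω) :
    ∀ᶠ p in inProb μ, P p.1 p.2 := by
  rw [eventually_inProb]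
  have : (fun n => μ {ω | ¬ P n ω}) = fun _ => 0 := funext fun n => ae_iff.1 (h n)
  rw [this]
  exact tendsto_const_nhds

theorem tendsto_fst_inProb : Tendsto (Prod.fst : ℕ × Ω → ℕ) (inProb μ) atTop := by
  rw [tendsto_atTop]
  intro N
  rw [eventually_inProb]
  refine tendsto_const_nhds.congr' ?_
  filter_upwards [eventually_ge_atTop N] with n hn
  simp [hn]

/-- A sequence of nonnegative random variables with bounded means, multiplied by constants tending
to zero, tends to zero in probability. -/
theorem tendsto_mul_inProb_zero {f : ℕ → Ω → ℝ} {r : ℕ → ℝ} {C : ℝ≥0∞} (hC : C ≠ ∞)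
    (hf : ∀ n, Measurable (f n)) (hf0 : ∀ n ω, 0 ≤ f n ω)
    (hint : ∀ n, ∫⁻ ω, ENNReal.ofReal (f n ω) ∂μ ≤ C)
    (hr : Tendsto r atTop (𝓝 0)) :
    Tendsto (fun p : ℕ × Ω => r p.1 * f p.1 p.2) (inProb μ) (𝓝 0) := by
  rw [Metric.tendsto_nhds]
  intro ε hε
  rw [eventually_inProb]
  have hlim : Tendsto (fun n => ENNReal.ofReal |r n| * C / ENNReal.ofReal ε) atTop (𝓝 0) := by
    have h1 : Tendsto (fun n => ENNReal.ofReal |r n|) atTop (𝓝 0) := by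
      have := ENNReal.tendsto_ofReal (tendsto_zero_iff_abs_tendsto_zero _ |>.1 hr)
      simpa using! this
    have h2 := ENNReal.Tendsto.mul_const (b := C / ENNReal.ofReal ε) h1 (Or.inr
      (ENNReal.div_ne_top hC (by simpa using hε)))
    simpa [mul_div_assoc] using h2
  refine tendsto_of_tendsto_of_tendsto_of_le_of_le tendsto_const_nhds hlim (fun _ => zero_le)
    (fun n => ?_)
  refine (measure_mono (t := {ω | ENNReal.ofReal ε ≤ ENNReal.ofReal (|r n| * f n ω)})
    fun ω hω => ?_).trans ((meas_ge_le_lintegral_div (by have := hf n; fun_prop)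
      (by simpa using hε) (by simp)).trans ?_)
  · simp only [Set.mem_ofPred_eq, dist_zero_right, not_lt, Real.norm_eq_abs, abs_mul,
      abs_of_nonneg (hf0 n ω)] at hω
    exact ENNReal.ofReal_le_ofReal hω
  · gcongr
    simp_rw [ENNReal.ofReal_mul (abs_nonneg (r n))]
    rw [lintegral_const_mul _ (by have := hf n; fun_prop)]
    gcongr
    exact hint n

end InProb

/-! ### Eigenvalues and quadratic forms -/

/-- The lower half of the Courant–Fischer principle: if the quadratic form of `A` is at least
`c ‖x‖²` on the range of an injective `P` with `k` columns, then the `k` largest eigenvalues of `A`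
are at least `c`. -/
theorem Matrix.IsHermitian.le_eigenvalues₀ {n : Type*} [Fintype n] [DecidableEq n]
    {A : Matrix n n ℝ} (hA : A.IsHermitian) {k : ℕ} (P : Matrix n (Fin k) ℝ) (c : ℝ)
    (hP : ∀ y, P *ᵥ y = 0 → y = 0)
    (h : ∀ y, c * ((P *ᵥ y) ⬝ᵥ (P *ᵥ y)) ≤ (P *ᵥ y) ⬝ᵥ (A *ᵥ (P *ᵥ y)))
    (l : Fin (Fintype.card n)) (hl : (l : ℕ) < k) : c ≤ hA.eigenvalues₀ l := by
  have hs := Matrix.isSymmetric_toEuclideanLin_iff.mpr hA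
  set b := hs.eigenvectorBasis (n := Fintype.card n) finrank_euclideanSpace with hb
  have hval : hA.eigenvalues₀ = hs.eigenvalues finrank_euclideanSpace := rfl
  -- a nonzero vector in the range of `P`, orthogonal to the first `l` eigenvectors
  let f : (Fin k → ℝ) →ₗ[ℝ] (Fin (l : ℕ) → ℝ) :=
    LinearMap.pi fun m => (LinearMap.proj (⟨m, m.2.trans l.2⟩ : Fin (Fintype.card n))) ∘ₗ
      ((WithLp.linearEquiv 2 ℝ (Fin (Fintype.card n) → ℝ)).toLinearMap ∘ₗ
      b.repr.toLinearEquiv.toLinearMap ∘ₗ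
      (WithLp.linearEquiv 2 ℝ (n → ℝ)).symm.toLinearMap ∘ₗ P.mulVecLin)
  have hker : LinearMap.ker f ≠ ⊥ := LinearMap.ker_ne_bot_of_finrank_lt (by simpa using hl)
  obtain ⟨y, hy, hy0⟩ := (Submodule.ne_bot_iff _).1 hker
  set x : EuclideanSpace ℝ n := WithLp.toLp 2 (P *ᵥ y) with hx
  have hlow : ∀ m : Fin (Fintype.card n), m < l → b.repr x m = 0 := by
    intro m hm
    have := congrFun (LinearMap.mem_ker.1 hy) ⟨m, hm⟩
    simpa [f] using this
  have hxx : (P *ᵥ y) ⬝ᵥ (P *ᵥ y) = ∑ m, (b.repr x m) ^ 2 := by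
    have h1 : inner ℝ x x = inner ℝ (b.repr x) (b.repr x) :=
      (b.repr.inner_map_map x x).symm
    simp only [PiLp.inner_apply, RCLike.inner_apply, conj_trivial] at h1
    simpa [dotProduct, hx, pow_two] using h1
  have hxA : (P *ᵥ y) ⬝ᵥ (A *ᵥ (P *ᵥ y)) =
      ∑ m, hA.eigenvalues₀ m * (b.repr x m) ^ 2 := by
    have h1 : inner ℝ x (Matrix.toEuclideanLin A x) =
        inner ℝ (b.repr x) (b.repr (Matrix.toEuclideanLin A x)) :=
      (b.repr.inner_map_map x _).symm
    simp only [PiLp.inner_apply, RCLike.inner_apply, conj_trivial, hb,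
      hs.eigenvectorBasis_apply_self_apply] at h1
    rw [hval]
    simp only [dotProduct]
    rw [← hb] at h1
    convert! h1 using 1
    · exact Finset.sum_congr rfl fun i _ => mul_comm _ _
    · refine Finset.sum_congr rfl fun m _ => ?_
      simp only [RCLike.ofReal_real_eq_id, id]
      ring
  have hpos : 0 < (P *ᵥ y) ⬝ᵥ (P *ᵥ y) := by
    have h0 : P *ᵥ y ≠ 0 := fun h => hy0 (hP y h)
    refine lt_of_le_of_ne (Finset.sum_nonneg fun i _ => mul_self_nonneg _) ?_
    exact fun h => h0 (dotProduct_self_eq_zero.1 h.symm)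
  have hup : (P *ᵥ y) ⬝ᵥ (A *ᵥ (P *ᵥ y)) ≤ hA.eigenvalues₀ l * ((P *ᵥ y) ⬝ᵥ (P *ᵥ y)) := by
    rw [hxA, hxx, Finset.mul_sum]
    refine Finset.sum_le_sum fun m _ => ?_
    rcases lt_or_ge m l with hm | hm
    · simp [hlow m hm]
    · exact mul_le_mul_of_nonneg_right (hA.eigenvalues₀_antitone hm) (sq_nonneg _)
  exact le_of_mul_le_mul_right ((h y).trans hup) hpos

theorem dotProduct_self_eq_norm_sq {ι : Type*} [Fintype ι] (y : ι → ℝ) :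
    y ⬝ᵥ y = ‖(WithLp.toLp 2 y : EuclideanSpace ℝ ι)‖ ^ 2 := by
  rw [EuclideanSpace.real_norm_sq_eq]
  simp [dotProduct, pow_two]

theorem Matrix.abs_dotProduct_mulVec_le {k : ℕ} (A : Matrix (Fin k) (Fin k) ℝ) (y : Fin k → ℝ) :
    |y ⬝ᵥ (A *ᵥ y)| ≤ ‖A‖ * (y ⬝ᵥ y) := by
  have h1 : y ⬝ᵥ (A *ᵥ y) = inner ℝ (WithLp.toLp 2 (A *ᵥ y)) (WithLp.toLp 2 y) := by
    simp [PiLp.inner_apply, dotProduct]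
  rw [h1, dotProduct_self_eq_norm_sq]
  refine (abs_real_inner_le_norm _ _).trans ?_
  rw [pow_two, ← mul_assoc]
  exact mul_le_mul_of_nonneg_right (A.l2_opNorm_mulVec (WithLp.toLp 2 y)) (norm_nonneg _)

theorem Matrix.PosDef.exists_pos_mul_le {k : ℕ} {A : Matrix (Fin k) (Fin k) ℝ} (hA : A.PosDef) :
    ∃ c > 0, ∀ y, c * (y ⬝ᵥ y) ≤ y ⬝ᵥ (A *ᵥ y) := by
  by_cases hne : (Metric.sphere (0 : EuclideanSpace ℝ (Fin k)) 1).Nonempty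
  · obtain ⟨x, hx, hmin⟩ := (isCompact_sphere (0 : EuclideanSpace ℝ (Fin k)) 1).exists_isMinOn hne
      (f := fun y => (y.ofLp) ⬝ᵥ (A *ᵥ y.ofLp)) (by fun_prop)
    have hx0 : x.ofLp ≠ 0 := by
      intro h
      have : x = 0 := by ext i; simp [h]
      simp [this] at hx
    refine ⟨_, by simpa using hA.dotProduct_mulVec_pos hx0, fun y => ?_⟩
    rcases eq_or_ne y 0 with rfl | hy
    · simp
    set n : ℝ := ‖(WithLp.toLp 2 y : EuclideanSpace ℝ (Fin k))‖ with hn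
    have hn0 : 0 < n := by
      rw [hn, norm_pos_iff]
      simpa using hy
    have h2 : y ⬝ᵥ y = n ^ 2 := dotProduct_self_eq_norm_sq y
    have hm := hmin (a := n⁻¹ • WithLp.toLp 2 y) (by simp [norm_smul, ← hn, hn0.ne', abs_of_pos hn0])
    simp only [Set.mem_ofPred_eq, WithLp.ofLp_smul, Matrix.mulVec_smul, dotProduct_smul,
      smul_dotProduct, smul_eq_mul] at hm
    rw [h2]
    calc _ ≤ (n⁻¹ * (n⁻¹ * (y ⬝ᵥ A *ᵥ y))) * n ^ 2 := by gcongr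
      _ = _ := by field_simp
  · refine ⟨1, one_pos, fun y => ?_⟩
    have : y = 0 := by
      by_contra hy
      refine hne ⟨‖(WithLp.toLp 2 y : EuclideanSpace ℝ (Fin k))‖⁻¹ • WithLp.toLp 2 y, ?_⟩
      have : ‖(WithLp.toLp 2 y : EuclideanSpace ℝ (Fin k))‖ ≠ 0 := by simpa using hy
      simp [norm_smul, this]
    simp [this]

/-- A uniform lower bound on a positive definite quadratic form persists along convergence. -/
theorem Matrix.PosDef.eventually_pos_mul_le {k : ℕ} {α : Type*} {F : Filter α}
    {A : α → Matrix (Fin k) (Fin k) ℝ} {A₀ : Matrix (Fin k) (Fin k) ℝ} (hA₀ : A₀.PosDef)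
    (hA : Tendsto A F (𝓝 A₀)) :
    ∃ c > 0, ∀ᶠ x in F, ∀ y, c * (y ⬝ᵥ y) ≤ y ⬝ᵥ (A x *ᵥ y) := by
  obtain ⟨c, hc, h⟩ := hA₀.exists_pos_mul_le
  refine ⟨c / 2, half_pos hc, ?_⟩
  filter_upwards [Metric.tendsto_nhds.1 hA (c / 2) (half_pos hc)] with x hx y
  have h1 := Matrix.abs_dotProduct_mulVec_le (A x - A₀) y
  rw [Matrix.sub_mulVec, dotProduct_sub, abs_le] at h1
  rw [dist_eq_norm] at hx
  have h3 : 0 ≤ y ⬝ᵥ y := Finset.sum_nonneg fun i _ => mul_self_nonneg _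
  nlinarith [h y, h1.1, mul_le_mul_of_nonneg_right hx.le h3]

/-! ### The limiting eigenproblem -/

/-- If the columns of `Y` are orthogonal with squared norms `v > 0` and `diag(d) Y = Y diag(v)`,
where `d` has distinct decreasing entries and `v` is decreasing, then `v = d` and `Y` is
diagonal: the `j`-th column lies in the eigenspace of `v j`, so that `v` is an injective selection
from `d`. -/
theorem eq_and_offDiag_eq_zero {k : ℕ} {Y : Matrix (Fin k) (Fin k) ℝ} {d v : Fin k → ℝ}
    (hd : StrictAnti d) (hv : Antitone v) (hpos : ∀ l, 0 < v l)
    (h1 : Matrix.diagonal d * Y = Y * Matrix.diagonal v) (h2 : Yᵀ * Y = Matrix.diagonal v) :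
    v = d ∧ ∀ i j, i ≠ j → Y i j = 0 := by
  have h1' : ∀ i j, Y i j ≠ 0 → v j = d i := by
    intro i j h
    have := congrFun (congrFun h1 i) j
    simp only [Matrix.diagonal_mul, Matrix.mul_diagonal] at this
    exact mul_right_cancel₀ h (by linarith)
  have h2' : ∀ i j, ∑ m, Y m i * Y m j = Matrix.diagonal v i j := by
    intro i j
    rw [← h2]
    simp [Matrix.mul_apply]
  have hex : ∀ j, ∃ i, Y i j ≠ 0 := by
    intro j
    by_contra! hc
    have := h2' j j
    simp only [hc, mul_zero, Finset.sum_const_zero, Matrix.diagonal_apply_eq] at this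
    exact (hpos j).ne this
  choose σ hσ using hex
  have hsupp : ∀ i j, i ≠ σ j → Y i j = 0 := by
    intro i j hij
    by_contra hc
    exact hij (hd.injective ((h1' i j hc).symm.trans (h1' _ j (hσ j))))
  have hinj : Function.Injective σ := by
    intro i j hij
    by_contra hne
    have := h2' i j
    rw [Matrix.diagonal_apply_ne _ hne, Finset.sum_eq_single (σ j)] at this
    · exact (mul_ne_zero (hij ▸ hσ i) (hσ j)) this
    · intro m _ hm
      simp [hsupp m j hm]
    · simp
  have hvd : ∀ j, v j = d (σ j) := fun j => h1' _ j (hσ j)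
  have hmono : StrictMono σ := by
    refine Monotone.strictMono_of_injective (fun i j hij => ?_) hinj
    by_contra hlt
    have := hd (not_le.1 hlt)
    rw [← hvd, ← hvd] at this
    exact absurd (hv hij) (not_le.2 this)
  have hid : σ = id := (hmono.range_inj strictMono_id).1 (by
    rw [(Finite.injective_iff_surjective.1 hinj).range_eq, Set.range_id])
  refine ⟨funext fun j => by rw [hvd, hid]; rfl, fun i j hij => hsupp i j (by rwa [hid])⟩

namespace IsLimitRotation

variable {k : ℕ} {SigL SigF Q : Matrix (Fin k) (Fin k) ℝ} {d : Fin k → ℝ}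

theorem pos (h : IsLimitRotation SigL SigF d Q) (l : Fin k) : 0 < d l := by
  obtain ⟨hL, -, -, S, γ, hS, -, hγ, hK, -⟩ := h
  have hSt : Sᵀ = S := by
    rw [← Matrix.conjTranspose_eq_transpose_of_trivial]
    exact hS.isHermitian
  have hD : Matrix.diagonal d = (S * γ)ᴴ * SigL * (S * γ) := by
    rw [Matrix.conjTranspose_mul]
    simp only [Matrix.conjTranspose_eq_transpose_of_trivial, hSt]
    calc Matrix.diagonal d = (γᵀ * γ) * Matrix.diagonal d := by rw [hγ, one_mul]
      _ = γᵀ * (S * SigL * S * γ) := by rw [hK, mul_assoc]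
      _ = _ := by simp only [mul_assoc]
  have hu : IsUnit (S * γ) := hS.isUnit.mul ((isUnit_iff_exists).2
    ⟨γᵀ, mul_eq_one_comm.1 hγ, hγ⟩)
  have hpd : (Matrix.diagonal d).PosDef := by
    rw [hD]
    exact hL.conjTranspose_mul_mul_same (Matrix.mulVec_injective_of_isUnit hu)
  exact (Matrix.posDef_diagonal_iff.1 hpd) l

/-- The limiting normal equations have only one solution with decreasing positive eigenvalues and
the prescribed signs. -/
theorem unique (h : IsLimitRotation SigL SigF d Q) {Z : Matrix (Fin k) (Fin k) ℝ} {v : Fin k → ℝ}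
    (hv : Antitone v) (hpos : ∀ l, 0 < v l) (h1 : SigL * SigF * Z = Z * Matrix.diagonal v)
    (h2 : Zᵀ * SigF * Z = Matrix.diagonal v) (hsign : ∀ l, 0 ≤ (Zᵀ * Q⁻¹) l l) :
    v = d ∧ Z = SigF⁻¹ * Q⁻¹ * Matrix.diagonal d := by
  have hd0 := h.pos
  obtain ⟨-, hF, hd, S, γ, hS, hSS, hγ, hK, hQ⟩ := h
  have hγ' : γ * γᵀ = 1 := mul_eq_one_comm.1 hγ
  have hSt : Sᵀ = S := by
    rw [← Matrix.conjTranspose_eq_transpose_of_trivial]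
    exact hS.isHermitian
  have hdet : IsUnit S.det := (Matrix.isUnit_iff_isUnit_det S).1 hS.isUnit
  have hS1 : S⁻¹ * S = 1 := Matrix.nonsing_inv_mul S hdet
  have hS2 : S * S⁻¹ = 1 := Matrix.mul_nonsing_inv S hdet
  have hK' : S * SigL * S = γ * Matrix.diagonal d * γᵀ := by
    rw [← hK, mul_assoc _ γ, hγ', mul_one]
  set Y := γᵀ * S * Z with hY
  have hSZ : S * Z = γ * Y := by
    rw [hY, ← mul_assoc, ← mul_assoc, hγ', one_mul]
  have e1 : Matrix.diagonal d * Y = Y * Matrix.diagonal v := by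
    calc Matrix.diagonal d * Y = (γᵀ * γ) * Matrix.diagonal d * γᵀ * S * Z := by
          rw [hγ, one_mul, hY]; simp only [mul_assoc]
      _ = γᵀ * (γ * Matrix.diagonal d * γᵀ) * S * Z := by simp only [mul_assoc]
      _ = γᵀ * S * (SigL * (S * S) * Z) := by rw [← hK']; simp only [mul_assoc]
      _ = Y * Matrix.diagonal v := by rw [hSS, h1, hY]; simp only [mul_assoc]
  have e2 : Yᵀ * Y = Matrix.diagonal v := by
    calc Yᵀ * Y = Zᵀ * S * (γ * γᵀ) * S * Z := by
          rw [hY]; simp only [Matrix.transpose_mul, Matrix.transpose_transpose, hSt, mul_assoc]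
      _ = Zᵀ * (S * S) * Z := by rw [hγ', mul_one]; simp only [mul_assoc]
      _ = _ := by rw [hSS, h2]
  obtain ⟨rfl, hoff⟩ := eq_and_offDiag_eq_zero hd hv hpos e1 e2
  refine ⟨rfl, ?_⟩
  have hsq : ∀ l, √(v l) ≠ 0 := fun l => (Real.sqrt_pos.2 (hd0 l)).ne'
  have hQinv : Q⁻¹ = S * γ * Matrix.diagonal fun l => (√(v l))⁻¹ := by
    refine Matrix.inv_eq_left_inv ?_
    calc S * γ * (Matrix.diagonal fun l => (√(v l))⁻¹) * Q
        = S * (γ * ((Matrix.diagonal fun l => (√(v l))⁻¹) * Matrix.diagonal fun l => √(v l)) *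
            γᵀ) * S⁻¹ := by rw [hQ]; simp only [mul_assoc]
      _ = 1 := by
          rw [Matrix.diagonal_mul_diagonal]
          simp [hsq, hγ', hS2]
  have hYd : Y = Matrix.diagonal fun l => √(v l) := by
    ext i j
    rcases eq_or_ne i j with rfl | hij
    · rw [Matrix.diagonal_apply_eq]
      have hs := hsign i
      have hZQ : Zᵀ * Q⁻¹ = Yᵀ * Matrix.diagonal fun l => (√(v l))⁻¹ := by
        rw [hQinv, hY]
        simp only [Matrix.transpose_mul, Matrix.transpose_transpose, hSt, mul_assoc]
      rw [hZQ, Matrix.mul_diagonal, Matrix.transpose_apply] at hs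
      have hY0 : 0 ≤ Y i i := nonneg_of_mul_nonneg_left hs
        (inv_pos.2 (Real.sqrt_pos.2 (hd0 i)))
      have := congrFun (congrFun e2 i) i
      rw [Matrix.mul_apply, Matrix.diagonal_apply_eq, Finset.sum_eq_single i
        (fun m _ hm => by rw [hoff m i hm, mul_zero]) (by simp)] at this
      rw [← this, Matrix.transpose_apply, Real.sqrt_mul_self hY0]
    · rw [hoff i j hij, Matrix.diagonal_apply_ne _ hij]
  have hF1 : SigF⁻¹ = S⁻¹ * S⁻¹ := by rw [← hSS, Matrix.mul_inv_rev]
  calc Z = S⁻¹ * (S * Z) := by rw [← mul_assoc, hS1, one_mul]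
    _ = S⁻¹ * (γ * ((Matrix.diagonal fun l => (√(v l))⁻¹) * Matrix.diagonal v)) := by
        rw [hSZ, hYd, Matrix.diagonal_mul_diagonal]
        congr 3
        ext l
        have h3 := Real.mul_self_sqrt (hd0 l).le
        have h4 := hsq l
        field_simp
        linarith
    _ = S⁻¹ * ((S⁻¹ * S) * (γ * ((Matrix.diagonal fun l => (√(v l))⁻¹) * Matrix.diagonal v))) := by
        rw [hS1, one_mul]
    _ = _ := by rw [hF1, hQinv]; simp only [mul_assoc]

theorem isUnit_det_right (h : IsLimitRotation SigL SigF d Q) : IsUnit SigF.det :=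
  (Matrix.isUnit_iff_isUnit_det _).1 h.2.1.isUnit

/-- Approximate solutions of the normal equations converge to the exact one. -/
theorem tendsto (h : IsLimitRotation SigL SigF d Q) {α : Type*} {F : Filter α}
    {W S Z E₁ E₂ : α → Matrix (Fin k) (Fin k) ℝ} {v : α → Fin k → ℝ} {B c : ℝ}
    (hW : Tendsto W F (𝓝 SigL)) (hS : Tendsto S F (𝓝 SigF))
    (hE₁ : Tendsto E₁ F (𝓝 0)) (hE₂ : Tendsto E₂ F (𝓝 0))
    (hB : ∀ᶠ x in F, ‖Z x‖ ≤ B) (hv : ∀ᶠ x in F, Antitone (v x)) (hc : 0 < c)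
    (hpos : ∀ᶠ x in F, ∀ l, c ≤ v x l)
    (h₁ : ∀ᶠ x in F, W x * S x * Z x + E₁ x = Z x * Matrix.diagonal (v x))
    (h₂ : ∀ᶠ x in F, (Z x)ᵀ * S x * Z x + E₂ x = Matrix.diagonal (v x))
    (hsign : ∀ᶠ x in F, ∀ l, 0 ≤ ((Z x)ᵀ * Q⁻¹) l l) :
    Tendsto (fun x => (Z x, v x)) F (𝓝 (SigF⁻¹ * Q⁻¹ * Matrix.diagonal d, d)) := by
  have : ProperSpace (Matrix (Fin k) (Fin k) ℝ) := FiniteDimensional.proper ℝ _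
  have hB0 : ∀ᶠ x in F, ‖v x‖ ≤ B * (‖SigF‖ + 1) * B + 1 := by
    have e1 : ∀ᶠ x in F, ‖S x‖ < ‖SigF‖ + 1 :=
      hS.norm.eventually_lt_const (by linarith)
    have e2 : ∀ᶠ x in F, ‖E₂ x‖ < 1 := by
      have := hE₂.norm
      rw [norm_zero] at this
      exact this.eventually_lt_const one_pos
    filter_upwards [hB, h₂, e1, e2] with x hx h2 hs he
    have hB' : 0 ≤ B := (norm_nonneg _).trans hx
    rw [← Matrix.l2_opNorm_diagonal (𝕜 := ℝ) (v x), ← h2]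
    refine (norm_add_le _ _).trans (add_le_add ?_ he.le)
    refine (norm_mul_le _ _).trans ?_
    have ht : ‖(Z x)ᵀ‖ ≤ B := by
      rw [← Matrix.conjTranspose_eq_transpose_of_trivial, Matrix.l2_opNorm_conjTranspose]
      exact hx
    have := norm_mul_le (Z x)ᵀ (S x)
    gcongr
    exact this.trans (by gcongr)
  refine ((isCompact_closedBall (0 : Matrix (Fin k) (Fin k) ℝ) B).prod (isCompact_closedBall
    (0 : Fin k → ℝ) (B * (‖SigF‖ + 1) * B + 1))).tendsto_nhds_of_unique_mapClusterPt ?_ ?_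
  · filter_upwards [hB, hB0] with x h1 h2
    simpa using ⟨h1, h2⟩
  · rintro ⟨Z', v'⟩ - hcl
    obtain ⟨U, hUF, hU⟩ := mapClusterPt_iff_ultrafilter.1 hcl
    have hZ : Tendsto Z U (𝓝 Z') := (continuous_fst.tendsto _).comp hU
    have hv' : Tendsto v U (𝓝 v') := (continuous_snd.tendsto _).comp hU
    have hvl : ∀ l, Tendsto (fun x => v x l) U (𝓝 (v' l)) := fun l => tendsto_pi_nhds.1 hv' l
    have hdiag : Tendsto (fun x => Matrix.diagonal (v x)) U (𝓝 (Matrix.diagonal v')) :=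
      ((continuous_id.matrix_diagonal).tendsto v').comp hv'
    have hZt : Tendsto (fun x => (Z x)ᵀ) U (𝓝 Z'ᵀ) :=
      ((continuous_id.matrix_transpose).tendsto Z').comp hZ
    have g1 : SigL * SigF * Z' = Z' * Matrix.diagonal v' := by
      have t1 := (((hW.mono_left hUF).mul (hS.mono_left hUF)).mul hZ).add (hE₁.mono_left hUF)
      rw [add_zero] at t1
      exact tendsto_nhds_unique (t1.congr' (h₁.filter_mono hUF)) (hZ.mul hdiag)
    have g2 : Z'ᵀ * SigF * Z' = Matrix.diagonal v' := by
      have t1 := ((hZt.mul (hS.mono_left hUF)).mul hZ).add (hE₂.mono_left hUF)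
      rw [add_zero] at t1
      exact tendsto_nhds_unique (t1.congr' (h₂.filter_mono hUF)) hdiag
    have g3 : Antitone v' := fun i j hij =>
      le_of_tendsto_of_tendsto (hvl j) (hvl i) ((hv.filter_mono hUF).mono fun x hx => hx hij)
    have g4 : ∀ l, 0 < v' l := fun l => hc.trans_le
      (ge_of_tendsto (hvl l) ((hpos.filter_mono hUF).mono fun x hx => hx l))
    have g5 : ∀ l, 0 ≤ (Z'ᵀ * Q⁻¹) l l := by
      intro l
      have t1 : Tendsto (fun x => ((Z x)ᵀ * Q⁻¹) l l) U (𝓝 ((Z'ᵀ * Q⁻¹) l l)) :=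
        tendsto_pi_nhds.1 (tendsto_pi_nhds.1 (hZt.mul_const (Q⁻¹)) l) l
      exact ge_of_tendsto t1 ((hsign.filter_mono hUF).mono fun x hx => hx l)
    obtain ⟨hv1, hZ1⟩ := h.unique g3 g4 g1 g2 g5
    rw [hv1, hZ1]

end IsLimitRotation

/-! ### Algebra of the estimation error -/

theorem Matrix.l2_opNorm_sq_le_sum_sq {m n : Type*} [Fintype m] [Fintype n] [DecidableEq n]
    (A : Matrix m n ℝ) : ‖A‖ ^ 2 ≤ ∑ i, ∑ j, A i j ^ 2 := by
  have h0 : (0 : ℝ) ≤ ∑ i, ∑ j, A i j ^ 2 :=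
    Finset.sum_nonneg fun i _ => Finset.sum_nonneg fun j _ => sq_nonneg _
  have h : ‖A‖ ≤ √(∑ i, ∑ j, A i j ^ 2) := by
    rw [Matrix.l2_opNorm_def]
    refine ContinuousLinearMap.opNorm_le_bound _ (Real.sqrt_nonneg _) fun x => ?_
    rw [EuclideanSpace.norm_eq, EuclideanSpace.norm_eq, ← Real.sqrt_mul h0]
    refine Real.sqrt_le_sqrt ?_
    rw [Finset.sum_mul]
    refine Finset.sum_le_sum fun i _ => ?_
    simpa [Matrix.mulVec, dotProduct] using!
      Finset.sum_mul_sq_le_sq_mul_sq Finset.univ (fun j => A i j) (fun j => x j)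
  calc ‖A‖ ^ 2 ≤ √(∑ i, ∑ j, A i j ^ 2) ^ 2 := by gcongr
    _ = _ := Real.sq_sqrt h0

namespace Panel

variable {Ω : Type*} {k r : ℕ}

theorem Y_apply (X : Panel Ω k r) (t : Fin X.T) (ω : Ω) (i : Fin X.a) (m : Fin X.b) :
    X.Y t ω i m = X.R ω i ⬝ᵥ X.FC ω t m + X.E t ω i m := by
  rw [Y, Matrix.mul_assoc, Matrix.add_apply, Matrix.mul_apply]
  rfl

theorem N_nonneg (X : Panel Ω k r) (i j : Fin X.a) (ω : Ω) : 0 ≤ X.N i j ω := Nat.cast_nonneg _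

theorem transpose_S (X : Panel Ω k r) (ω : Ω) : (X.S ω)ᵀ = X.S ω := by
  simp only [S, Matrix.transpose_smul, Matrix.transpose_sum, Matrix.transpose_mul,
    Matrix.transpose_transpose, Matrix.mul_assoc]

/-- The average of the noise covariances over the common observations of two rows. -/
noncomputable def meanErr [MeasurableSpace Ω] (X : Panel Ω k r) (μ : Measure Ω)
    (ω : Ω) (i j : Fin X.a) : ℝ :=
  (1 / X.N i j ω) * ∑ p ∈ X.Q i j ω, ∫ ω', X.E p.1 ω' i p.2 * X.E p.1 ω' j p.2 ∂μ

theorem abs_meanErr_le [MeasurableSpace Ω] (X : Panel Ω k r) (μ : Measure Ω)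
    (ω : Ω) (i j : Fin X.a) {τ : ℝ} (hτ0 : 0 ≤ τ)
    (hτ : ∀ t m, |∫ ω, X.E t ω i m * X.E t ω j m ∂μ| ≤ τ) : |X.meanErr μ ω i j| ≤ τ := by
  rw [meanErr, abs_mul, abs_of_nonneg (one_div_nonneg.2 (X.N_nonneg i j ω))]
  rcases (X.N_nonneg i j ω).eq_or_lt with h | h
  · simpa [← h] using hτ0
  · rw [one_div, inv_mul_le_iff₀ h]
    refine (Finset.abs_sum_le_sum_abs _ _).trans ?_
    exact (Finset.sum_le_card_nsmul _ _ τ fun p _ => hτ p.1 p.2).trans_eq (by simp [N])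

/-- The deviation of `a • M̂` from the signal `R S Rᵀ`. -/
noncomputable def resid (X : Panel Ω k r) (ω : Ω) : Matrix (Fin X.a) (Fin X.a) ℝ :=
  (X.a : ℝ) • X.Mhat ω - X.R ω * X.S ω * (X.R ω)ᵀ

theorem transpose_resid (X : Panel Ω k r) (ω : Ω) : (X.resid ω)ᵀ = X.resid ω := by
  have h : (X.Mhat ω)ᵀ = X.Mhat ω := by
    rw [← Matrix.conjTranspose_eq_transpose_of_trivial]
    exact X.Mhat_isHermitian ω
  simp only [resid, Matrix.transpose_sub, Matrix.transpose_smul, h, Matrix.transpose_mul,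
    Matrix.transpose_transpose, transpose_S, Matrix.mul_assoc]

/-- The residual consists of a term due to the missing entries, two cross terms between factors
and noise, the centred noise products, and the noise covariances. -/
theorem resid_apply [MeasurableSpace Ω] (X : Panel Ω k r) (μ : Measure Ω) (ω : Ω)
    (i j : Fin X.a) :
    X.resid ω i j = X.R ω i ⬝ᵥ ((X.SQ ω i j - X.S ω) *ᵥ X.R ω j)
      + X.R ω i ⬝ᵥ ((1 / X.N i j ω) • X.factorErr ω i j j)
      + ((1 / X.N i j ω) • X.factorErr ω i j i) ⬝ᵥ X.R ω j
      + (1 / X.N i j ω) * X.centeredErr μ ω i j + X.meanErr μ ω i j := by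
  have ha : (X.a : ℝ) ≠ 0 := by
    have := i.pos
    positivity
  have h1 : (X.R ω * X.S ω * (X.R ω)ᵀ) i j = X.R ω i ⬝ᵥ (X.S ω *ᵥ X.R ω j) := by
    rw [Matrix.mul_assoc, Matrix.mul_apply]; rfl
  have h2 : X.R ω i ⬝ᵥ (X.SQ ω i j *ᵥ X.R ω j) = (1 / X.N i j ω) * ∑ p ∈ X.Q i j ω,
      (X.R ω i ⬝ᵥ X.FC ω p.1 p.2) * (X.R ω j ⬝ᵥ X.FC ω p.1 p.2) := by
    rw [SQ, Matrix.smul_mulVec, dotProduct_smul, Matrix.sum_mulVec, dotProduct_sum, smul_eq_mul]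
    congr 1
    refine Finset.sum_congr rfl fun p _ => ?_
    rw [Matrix.vecMulVec_mulVec, dotProduct_comm (X.R ω j)]
    simp [mul_comm]
  have h3 : ∀ l l', X.R ω l ⬝ᵥ ((1 / X.N i j ω) • X.factorErr ω i j l') = (1 / X.N i j ω) *
      ∑ p ∈ X.Q i j ω, X.E p.1 ω l' p.2 * (X.R ω l ⬝ᵥ X.FC ω p.1 p.2) := by
    intro l l'
    rw [dotProduct_smul, factorErr, dotProduct_sum, smul_eq_mul]
    simp only [dotProduct_smul, smul_eq_mul]
  have h4 : (X.a : ℝ) * X.Mhat ω i j = (1 / X.N i j ω) *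
      ∑ p ∈ X.Q i j ω, X.Y p.1 ω i p.2 * X.Y p.1 ω j p.2 := by
    rw [Mhat, Matrix.of_apply]
    field_simp
  rw [resid, Matrix.sub_apply, Matrix.smul_apply, smul_eq_mul, h1, h4, Matrix.sub_mulVec,
    dotProduct_sub, h2, dotProduct_comm _ (X.R ω j), h3, h3, centeredErr, meanErr,
    Finset.sum_sub_distrib]
  have h5 : ∑ p ∈ X.Q i j ω, X.Y p.1 ω i p.2 * X.Y p.1 ω j p.2 =
      ∑ p ∈ X.Q i j ω, (X.R ω i ⬝ᵥ X.FC ω p.1 p.2) * (X.R ω j ⬝ᵥ X.FC ω p.1 p.2)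
      + ∑ p ∈ X.Q i j ω, X.E p.1 ω j p.2 * (X.R ω i ⬝ᵥ X.FC ω p.1 p.2)
      + ∑ p ∈ X.Q i j ω, X.E p.1 ω i p.2 * (X.R ω j ⬝ᵥ X.FC ω p.1 p.2)
      + ∑ p ∈ X.Q i j ω, X.E p.1 ω i p.2 * X.E p.1 ω j p.2 := by
    simp only [← Finset.sum_add_distrib]
    refine Finset.sum_congr rfl fun p _ => ?_
    rw [Y_apply, Y_apply]
    ring
  rw [h5]
  ring

/-- The normalised squared Frobenius norm of the residual matrix. -/
noncomputable def meanSqResid (X : Panel Ω k r) (ω : Ω) : ℝ :=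
  (1 / (X.a : ℝ) ^ 2) * ∑ i, ∑ j, X.resid ω i j ^ 2

/-- The mean square of the `j`-th column of the residual matrix. -/
noncomputable def colSqResid (X : Panel Ω k r) (ω : Ω) (j : Fin X.a) : ℝ :=
  (1 / (X.a : ℝ)) * ∑ i, X.resid ω i j ^ 2

theorem meanSqResid_nonneg (X : Panel Ω k r) (ω : Ω) : 0 ≤ X.meanSqResid ω :=
  mul_nonneg (by positivity)
    (Finset.sum_nonneg fun i _ => Finset.sum_nonneg fun j _ => sq_nonneg _)

theorem colSqResid_nonneg (X : Panel Ω k r) (ω : Ω) (j : Fin X.a) : 0 ≤ X.colSqResid ω j :=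
  mul_nonneg (by positivity) (Finset.sum_nonneg fun i _ => sq_nonneg _)

theorem norm_resid_le (X : Panel Ω k r) (ω : Ω) : ‖X.resid ω‖ ≤ X.a * √(X.meanSqResid ω) := by
  rcases Nat.eq_zero_or_pos X.a with h | h
  · have : X.resid ω = 0 := by
      ext i
      exact absurd i.pos (by omega)
    simp [this, h]
  · have ha : (0 : ℝ) < X.a := by exact_mod_cast h
    refine abs_le_of_sq_le_sq' ?_ (by positivity) |>.2
    rw [mul_pow, Real.sq_sqrt (X.meanSqResid_nonneg ω), meanSqResid]
    refine (Matrix.l2_opNorm_sq_le_sum_sq _).trans_eq ?_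
    field_simp

theorem Mhat_eq (X : Panel Ω k r) (ω : Ω) :
    X.Mhat ω = (1 / (X.a : ℝ)) • (X.R ω * X.S ω * (X.R ω)ᵀ + X.resid ω) := by
  ext i j
  have ha : (X.a : ℝ) ≠ 0 := by
    have := i.pos
    positivity
  simp [resid, ha]

theorem antitone_eigval (X : Panel Ω k r) (ω : Ω) (hk : k ≤ X.a) : Antitone (X.eigval ω) := by
  intro l l' h
  have hl : ∀ l : Fin k, (l : ℕ) < Fintype.card (Fin X.a) := fun l => by
    simpa using l.2.trans_le hk
  rw [eigval, eigval, dif_pos (hl l), dif_pos (hl l')]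
  exact Matrix.IsHermitian.eigenvalues₀_antitone _ (by simpa using! h)

theorem norm_R_sq (X : Panel Ω k r) (ω : Ω) (ha : (X.a : ℝ) ≠ 0) :
    ‖X.R ω‖ ^ 2 = X.a * ‖(1 / (X.a : ℝ)) • ((X.R ω)ᵀ * X.R ω)‖ := by
  rw [pow_two, ← Matrix.l2_opNorm_conjTranspose_mul_self,
    Matrix.conjTranspose_eq_transpose_of_trivial, norm_smul]
  simp
  field_simp

theorem H_eq (X : Panel Ω k r) (ω : Ω) (Rhat : Matrix (Fin X.a) (Fin k) ℝ) :
    X.H ω Rhat = X.S ω * ((1 / (X.a : ℝ)) • ((X.R ω)ᵀ * Rhat)) *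
      (Matrix.diagonal (X.eigval ω))⁻¹ := by
  simp only [H, S, Matrix.smul_mul, Matrix.mul_smul, smul_smul, Matrix.mul_assoc, one_div, mul_inv]
  congr 1
  ring

theorem err_apply (X : Panel Ω k r) (ω : Ω) (Rhat : Matrix (Fin X.a) (Fin k) ℝ) (j : Fin X.a)
    (l : Fin k) : X.err ω Rhat j l = (Rhat - X.R ω * X.H ω Rhat) j l := by
  simp only [err, Pi.sub_apply, Matrix.sub_apply, Matrix.mul_apply, Matrix.mulVec, dotProduct,
    Matrix.transpose_apply, mul_comm]

namespace IsEstimator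

variable {X : Panel Ω k r} {ω : Ω} {Rhat : Matrix (Fin X.a) (Fin k) ℝ}

theorem a_ne_zero (h : X.IsEstimator ω Rhat) (l : Fin k) : (X.a : ℝ) ≠ 0 := by
  intro ha
  have := congrFun (congrFun h.1 l) l
  simp [ha] at this

/-- The rank of `Rhatᵀ * Rhat` forces at least `k` rows. -/
theorem le_a (h : X.IsEstimator ω Rhat) : k ≤ X.a := by
  have h1 : ((1 / (X.a : ℝ)) • Rhatᵀ) * Rhat = 1 := by rw [Matrix.smul_mul]; exact h.1
  have h2 := Matrix.rank_mul_le_right ((1 / (X.a : ℝ)) • Rhatᵀ) Rhat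
  rw [h1, Matrix.rank_one] at h2
  simpa using h2.trans (Matrix.rank_le_height Rhat)

theorem transpose_mul_self (h : X.IsEstimator ω Rhat) : Rhatᵀ * Rhat = (X.a : ℝ) • 1 := by
  ext l m
  have ha := h.a_ne_zero l
  rw [← h.1, smul_smul]
  simp [ha]

theorem norm_sq_le (h : X.IsEstimator ω Rhat) : ‖Rhat‖ ^ 2 ≤ X.a := by
  rw [pow_two, ← Matrix.l2_opNorm_conjTranspose_mul_self,
    Matrix.conjTranspose_eq_transpose_of_trivial, h.transpose_mul_self, norm_smul]
  have : ‖(1 : Matrix (Fin k) (Fin k) ℝ)‖ ≤ 1 := by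
    rw [← Matrix.diagonal_one, Matrix.l2_opNorm_diagonal]
    exact (pi_norm_le_iff_of_nonneg zero_le_one).2 fun i => by simp
  simpa using mul_le_mul_of_nonneg_left this (Nat.cast_nonneg X.a)

/-- The projection of the eigenvalue equation on the true loadings. -/
theorem normal_eq_left (h : X.IsEstimator ω Rhat) :
    ((1 / (X.a : ℝ)) • ((X.R ω)ᵀ * X.R ω)) * X.S ω * ((1 / (X.a : ℝ)) • ((X.R ω)ᵀ * Rhat)) +
      (1 / (X.a : ℝ) ^ 2) • ((X.R ω)ᵀ * X.resid ω * Rhat) =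
    ((1 / (X.a : ℝ)) • ((X.R ω)ᵀ * Rhat)) * Matrix.diagonal (X.eigval ω) := by
  rw [Matrix.smul_mul _ _ (Matrix.diagonal _), Matrix.mul_assoc _ Rhat, ← h.2, Mhat_eq]
  simp only [Matrix.smul_mul, Matrix.mul_smul, smul_smul, Matrix.add_mul, Matrix.mul_add,
    smul_add, Matrix.mul_assoc, pow_two, one_div, mul_inv]

/-- The projection of the eigenvalue equation on the estimated loadings. -/
theorem normal_eq_right (h : X.IsEstimator ω Rhat) :
    ((1 / (X.a : ℝ)) • ((X.R ω)ᵀ * Rhat))ᵀ * X.S ω * ((1 / (X.a : ℝ)) • ((X.R ω)ᵀ * Rhat)) +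
      (1 / (X.a : ℝ) ^ 2) • (Rhatᵀ * X.resid ω * Rhat) = Matrix.diagonal (X.eigval ω) := by
  have h1 : Matrix.diagonal (X.eigval ω) = (1 / (X.a : ℝ)) • (Rhatᵀ * (X.Mhat ω * Rhat)) := by
    rw [h.2, ← Matrix.mul_assoc, ← Matrix.smul_mul, h.1, Matrix.one_mul]
  rw [h1, Mhat_eq]
  simp only [Matrix.smul_mul, Matrix.mul_smul, smul_smul, Matrix.add_mul, Matrix.mul_add,
    smul_add, Matrix.mul_assoc, pow_two, one_div, mul_inv, Matrix.transpose_smul, Matrix.transpose_mul,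
    Matrix.transpose_transpose]

theorem norm_cross_sq_le (h : X.IsEstimator ω Rhat) :
    ‖(1 / (X.a : ℝ)) • ((X.R ω)ᵀ * Rhat)‖ ^ 2 ≤
      ‖(1 / (X.a : ℝ)) • ((X.R ω)ᵀ * X.R ω)‖ := by
  by_cases ha : (X.a : ℝ) = 0
  · simp [ha]
  have h1 : ‖(X.R ω)ᵀ * Rhat‖ ≤ ‖X.R ω‖ * ‖Rhat‖ := by
    refine (Matrix.l2_opNorm_mul _ _).trans_eq ?_
    rw [← Matrix.conjTranspose_eq_transpose_of_trivial, Matrix.l2_opNorm_conjTranspose]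
  have ha' : (0 : ℝ) < X.a := lt_of_le_of_ne (Nat.cast_nonneg _) (Ne.symm ha)
  rw [norm_smul, mul_pow]
  calc ‖1 / (X.a : ℝ)‖ ^ 2 * ‖(X.R ω)ᵀ * Rhat‖ ^ 2
      ≤ ‖1 / (X.a : ℝ)‖ ^ 2 * (‖X.R ω‖ ^ 2 * ‖Rhat‖ ^ 2) := by
        rw [← mul_pow ‖X.R ω‖]
        exact mul_le_mul_of_nonneg_left (pow_le_pow_left₀ (norm_nonneg _) h1 2) (by positivity)
    _ ≤ ‖1 / (X.a : ℝ)‖ ^ 2 * ((X.a * ‖(1 / (X.a : ℝ)) • ((X.R ω)ᵀ * X.R ω)‖) * X.a) := by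
        rw [norm_R_sq X ω ha]; gcongr; exact h.norm_sq_le
    _ = _ := by
        rw [Real.norm_of_nonneg (by positivity)]
        field_simp

theorem norm_resid_right_le (h : X.IsEstimator ω Rhat) :
    ‖(1 / (X.a : ℝ) ^ 2) • (Rhatᵀ * X.resid ω * Rhat)‖ ≤ √(X.meanSqResid ω) := by
  have h1 : ‖Rhatᵀ * X.resid ω * Rhat‖ ≤ X.a * √(X.meanSqResid ω) * X.a := by
    calc _ ≤ ‖Rhatᵀ‖ * ‖X.resid ω‖ * ‖Rhat‖ :=
          (Matrix.l2_opNorm_mul _ _).trans (by gcongr; exact Matrix.l2_opNorm_mul _ _)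
      _ = ‖X.resid ω‖ * ‖Rhat‖ ^ 2 := by
          rw [← Matrix.conjTranspose_eq_transpose_of_trivial, Matrix.l2_opNorm_conjTranspose]; ring
      _ ≤ _ := by
          gcongr
          · exact X.norm_resid_le ω
          · exact h.norm_sq_le
  rw [norm_smul, Real.norm_of_nonneg (by positivity)]
  rcases (Nat.cast_nonneg X.a : (0 : ℝ) ≤ X.a).eq_or_lt with ha | ha
  · simp [← ha]
  · rw [one_div, inv_mul_le_iff₀ (by positivity)]
    exact h1.trans_eq (by ring)

theorem norm_resid_left_le (h : X.IsEstimator ω Rhat) :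
    ‖(1 / (X.a : ℝ) ^ 2) • ((X.R ω)ᵀ * X.resid ω * Rhat)‖ ≤
      √‖(1 / (X.a : ℝ)) • ((X.R ω)ᵀ * X.R ω)‖ * √(X.meanSqResid ω) := by
  by_cases ha : (X.a : ℝ) = 0
  · simp [ha]
  have ha' : (0 : ℝ) < X.a := lt_of_le_of_ne (Nat.cast_nonneg _) (Ne.symm ha)
  have hR : ‖X.R ω‖ = √X.a * √‖(1 / (X.a : ℝ)) • ((X.R ω)ᵀ * X.R ω)‖ := by
    rw [← Real.sqrt_mul ha'.le, ← norm_R_sq X ω ha, Real.sqrt_sq (norm_nonneg _)]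
  have hRh : ‖Rhat‖ ≤ √X.a := Real.le_sqrt_of_sq_le h.norm_sq_le
  have h1 : ‖(X.R ω)ᵀ * X.resid ω * Rhat‖ ≤
      (√X.a * √‖(1 / (X.a : ℝ)) • ((X.R ω)ᵀ * X.R ω)‖) * (X.a * √(X.meanSqResid ω)) * √X.a := by
    calc _ ≤ ‖(X.R ω)ᵀ‖ * ‖X.resid ω‖ * ‖Rhat‖ :=
          (Matrix.l2_opNorm_mul _ _).trans (by gcongr; exact Matrix.l2_opNorm_mul _ _)
      _ = ‖X.R ω‖ * ‖X.resid ω‖ * ‖Rhat‖ := by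
          rw [← Matrix.conjTranspose_eq_transpose_of_trivial, Matrix.l2_opNorm_conjTranspose]
      _ ≤ _ := by
          rw [hR]
          gcongr
          exact X.norm_resid_le ω
  rw [norm_smul, Real.norm_of_nonneg (by positivity), one_div, inv_mul_le_iff₀ (by positivity)]
  refine h1.trans_eq ?_
  have := Real.mul_self_sqrt ha'.le
  linear_combination (X.a * √‖(1 / (X.a : ℝ)) • ((X.R ω)ᵀ * X.R ω)‖ * √(X.meanSqResid ω)) * this

/-- On the range of `R`, the quadratic form of `M̂` dominates the one of the signal up to the size
of the residual; so the `k` largest eigenvalues of `M̂` inherit lower bounds from the signal. -/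
theorem le_eigval (h : X.IsEstimator ω Rhat) {c c₁ : ℝ} (hc₁ : 0 < c₁)
    (hR : ∀ y, c₁ * (y ⬝ᵥ y) ≤ y ⬝ᵥ (((1 / (X.a : ℝ)) • ((X.R ω)ᵀ * X.R ω)) *ᵥ y))
    (hRS : ∀ y, (c + √(X.meanSqResid ω)) *
        (y ⬝ᵥ (((1 / (X.a : ℝ)) • ((X.R ω)ᵀ * X.R ω)) *ᵥ y)) ≤
      y ⬝ᵥ ((((1 / (X.a : ℝ)) • ((X.R ω)ᵀ * X.R ω)) * X.S ω *
        ((1 / (X.a : ℝ)) • ((X.R ω)ᵀ * X.R ω))) *ᵥ y)) (l : Fin k) :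
    c ≤ X.eigval ω l := by
  have ha := h.a_ne_zero l
  have ha' : (0 : ℝ) < X.a := lt_of_le_of_ne (Nat.cast_nonneg _) (Ne.symm ha)
  have hcard : (l : ℕ) < Fintype.card (Fin X.a) := by simpa using l.2.trans_le h.le_a
  rw [eigval, dif_pos hcard]
  have hquad : ∀ y, (X.R ω *ᵥ y) ⬝ᵥ (X.R ω *ᵥ y) =
      X.a * (y ⬝ᵥ (((1 / (X.a : ℝ)) • ((X.R ω)ᵀ * X.R ω)) *ᵥ y)) := by
    intro y
    rw [Matrix.smul_mulVec, dotProduct_smul, ← Matrix.mulVec_mulVec, Matrix.mulVec_transpose,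
      dotProduct_comm y, ← Matrix.dotProduct_mulVec, smul_eq_mul]
    field_simp
  refine Matrix.IsHermitian.le_eigenvalues₀ _ (X.R ω) c (fun y hy => ?_) (fun y => ?_) _ l.2
  · have h1 := hquad y
    rw [hy, dotProduct_zero] at h1
    have h2 : y ⬝ᵥ (((1 / (X.a : ℝ)) • ((X.R ω)ᵀ * X.R ω)) *ᵥ y) = 0 := by
      rcases mul_eq_zero.1 h1.symm with h | h
      · exact absurd h ha
      · exact h
    have h3 := hR y
    rw [h2] at h3
    have h4 : 0 ≤ y ⬝ᵥ y := Finset.sum_nonneg fun i _ => mul_self_nonneg _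
    exact dotProduct_self_eq_zero.1 (by nlinarith)
  · set x := X.R ω *ᵥ y with hx
    have h1 : x ⬝ᵥ (X.Mhat ω *ᵥ x) = X.a * (y ⬝ᵥ ((((1 / (X.a : ℝ)) • ((X.R ω)ᵀ * X.R ω)) *
        X.S ω * ((1 / (X.a : ℝ)) • ((X.R ω)ᵀ * X.R ω))) *ᵥ y)) +
        (1 / (X.a : ℝ)) * (x ⬝ᵥ (X.resid ω *ᵥ x)) := by
      have e1 : y ⬝ᵥ (((X.R ω)ᵀ * (X.R ω * (X.S ω * ((X.R ω)ᵀ * X.R ω)))) *ᵥ y) =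
          x ⬝ᵥ ((X.R ω * (X.S ω * (X.R ω)ᵀ)) *ᵥ x) := by
        rw [← Matrix.mulVec_mulVec, Matrix.mulVec_transpose, dotProduct_comm y,
          ← Matrix.dotProduct_mulVec, dotProduct_comm, hx]
        simp only [Matrix.mulVec_mulVec, Matrix.mul_assoc]
      rw [Mhat_eq, Matrix.smul_mulVec, Matrix.add_mulVec, dotProduct_smul, dotProduct_add,
        smul_eq_mul]
      simp only [Matrix.smul_mul, Matrix.mul_smul, smul_smul, Matrix.mul_assoc, Matrix.smul_mulVec,
        dotProduct_smul, smul_eq_mul, e1]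
      field_simp
    have h2 := Matrix.abs_dotProduct_mulVec_le (X.resid ω) x
    have h3 : 0 ≤ x ⬝ᵥ x := Finset.sum_nonneg fun i _ => mul_self_nonneg _
    have h4 : |x ⬝ᵥ (X.resid ω *ᵥ x)| ≤ X.a * √(X.meanSqResid ω) * (x ⬝ᵥ x) :=
      h2.trans (mul_le_mul_of_nonneg_right (X.norm_resid_le ω) h3)
    have h5 : -(√(X.meanSqResid ω) * (x ⬝ᵥ x)) ≤ (1 / (X.a : ℝ)) * (x ⬝ᵥ (X.resid ω *ᵥ x)) := by
      have := (abs_le.1 h4).1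
      rw [one_div, ← div_eq_inv_mul, le_div_iff₀ ha']
      linarith
    rw [h1]
    have h6 := mul_le_mul_of_nonneg_left (hRS y) ha'.le
    have h7 := hquad y
    rw [← hx] at h7
    rw [mul_left_comm, ← h7] at h6
    linarith

theorem sub_mul_H (h : X.IsEstimator ω Rhat) (hv : ∀ l, X.eigval ω l ≠ 0) :
    Rhat - X.R ω * X.H ω Rhat =
      (1 / (X.a : ℝ)) • (X.resid ω * Rhat * (Matrix.diagonal (X.eigval ω))⁻¹) := by
  have hu : IsUnit (Matrix.diagonal (X.eigval ω)).det := by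
    rw [Matrix.det_diagonal]
    exact (Finset.prod_ne_zero_iff.2 fun l _ => hv l).isUnit
  have h1 : Rhat = X.Mhat ω * Rhat * (Matrix.diagonal (X.eigval ω))⁻¹ := by
    rw [h.2, Matrix.mul_nonsing_inv_cancel_right _ _ hu]
  rw [sub_eq_iff_eq_add, H_eq]
  conv_lhs => rw [h1, Mhat_eq]
  simp only [Matrix.smul_mul, Matrix.mul_smul, Matrix.add_mul, smul_add, Matrix.mul_assoc]
  rw [add_comm]

theorem err_eq (h : X.IsEstimator ω Rhat) (hv : ∀ l, X.eigval ω l ≠ 0) (j : Fin X.a)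
    (l : Fin k) :
    X.err ω Rhat j l =
      (X.eigval ω l)⁻¹ * ((1 / (X.a : ℝ)) * (X.resid ω *ᵥ fun i => Rhat i l) j) := by
  have hinv : (Matrix.diagonal (X.eigval ω))⁻¹ = Matrix.diagonal fun l => (X.eigval ω l)⁻¹ := by
    refine Matrix.inv_eq_left_inv ?_
    simp [Matrix.diagonal_mul_diagonal, hv]
  rw [err_apply, h.sub_mul_H hv, hinv, Matrix.smul_apply, Matrix.mul_diagonal, smul_eq_mul]
  simp only [Matrix.mul_apply, Matrix.mulVec, dotProduct]
  ring

/-- The first-order expansion of the estimation error of one loading vector. -/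
theorem err_expansion (h : X.IsEstimator ω Rhat) (hv : ∀ l, X.eigval ω l ≠ 0) (j : Fin X.a)
    (l : Fin k) :
    X.err ω Rhat j l = (X.eigval ω l)⁻¹ *
      (∑ m, X.H ω Rhat m l * ((1 / (X.a : ℝ)) * ∑ i, X.resid ω i j * X.R ω i m)
        + (1 / (X.a : ℝ)) * ∑ i, X.resid ω i j * X.err ω Rhat i l) := by
  rw [h.err_eq hv]
  congr 1
  have h1 : ∀ i, Rhat i l = ∑ m, X.R ω i m * X.H ω Rhat m l + X.err ω Rhat i l := by
    intro i
    rw [err_apply, Matrix.sub_apply, Matrix.mul_apply]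
    ring
  have h2 : ∀ i, X.resid ω j i = X.resid ω i j := fun i =>
    congrFun (congrFun (X.transpose_resid ω) i) j
  simp only [Matrix.mulVec, dotProduct]
  simp_rw [h2, Finset.mul_sum]
  rw [Finset.sum_comm, ← Finset.sum_add_distrib]
  refine Finset.sum_congr rfl fun i _ => ?_
  rw [h1 i, mul_add, mul_add, Finset.mul_sum, Finset.mul_sum]
  congr 1
  exact Finset.sum_congr rfl fun m _ => by ring

theorem sum_err_sq_le (h : X.IsEstimator ω Rhat) (hv : ∀ l, X.eigval ω l ≠ 0) (l : Fin k) :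
    (1 / (X.a : ℝ)) * ∑ i, X.err ω Rhat i l ^ 2 ≤
      (X.eigval ω l)⁻¹ ^ 2 * X.meanSqResid ω := by
  have ha := h.a_ne_zero l
  have ha' : (0 : ℝ) < X.a := lt_of_le_of_ne (Nat.cast_nonneg _) (Ne.symm ha)
  have hn : ∑ i, Rhat i l ^ 2 = X.a := by
    have := congrFun (congrFun h.transpose_mul_self l) l
    simpa [Matrix.mul_apply, pow_two] using this
  have h1 : ∀ i, X.err ω Rhat i l ^ 2 ≤ (X.eigval ω l)⁻¹ ^ 2 * ((1 / (X.a : ℝ)) ^ 2 *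
      ((∑ j, X.resid ω i j ^ 2) * X.a)) := by
    intro i
    rw [h.err_eq hv, mul_pow, mul_pow, ← hn]
    gcongr
    exact Finset.sum_mul_sq_le_sq_mul_sq Finset.univ (X.resid ω i) fun j => Rhat j l
  calc _ ≤ (1 / (X.a : ℝ)) * ∑ i, (X.eigval ω l)⁻¹ ^ 2 * ((1 / (X.a : ℝ)) ^ 2 *
      ((∑ j, X.resid ω i j ^ 2) * X.a)) := by
        gcongr with i
        exact h1 i
    _ = _ := by
        rw [← Finset.mul_sum, ← Finset.mul_sum, ← Finset.sum_mul, meanSqResid]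
        field_simp

end IsEstimator

end Panel

/-! ### Measurability and moment bounds -/

theorem measurable_norm_of_entries {Ω : Type*} [MeasurableSpace Ω] {m n : ℕ}
    {A : Ω → Matrix (Fin m) (Fin n) ℝ} (hA : ∀ i j, Measurable fun ω => A ω i j) :
    Measurable fun ω => ‖A ω‖ := by
  have h : Measurable fun ω => (fun i j => A ω i j : Fin m → Fin n → ℝ) :=
    measurable_pi_lambda _ fun i => measurable_pi_lambda _ fun j => hA i j
  have hc : Continuous fun B : Fin m → Fin n → ℝ => ‖Matrix.of B‖ :=
    continuous_norm.comp (by exact continuous_id)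
  exact hc.measurable.comp h

theorem measurable_toLp_of_entries {Ω : Type*} [MeasurableSpace Ω] {m : ℕ}
    {x : Ω → Fin m → ℝ} (hx : ∀ i, Measurable fun ω => x ω i) :
    Measurable fun ω => (WithLp.toLp 2 (x ω) : EuclideanSpace ℝ (Fin m)) :=
  (WithLp.measurable_toLp 2 _).comp (measurable_pi_lambda _ hx)

section Moments

variable {Ω : Type*} [MeasurableSpace Ω] {μ : Measure Ω}

theorem lintegral_ofReal_norm_sq_le_of_two {E : Type*} [SeminormedAddCommGroup E] {f : Ω → E}
    {C : ℝ≥0∞} (h : ∫⁻ ω, ‖f ω‖ₑ ^ 2 ∂μ ≤ C) : ∫⁻ ω, ENNReal.ofReal (‖f ω‖ ^ 2) ∂μ ≤ C := by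
  refine (lintegral_mono fun ω => ?_).trans h
  rw [ENNReal.ofReal_pow (norm_nonneg _), ofReal_norm]

theorem lintegral_ofReal_norm_sq_le_of_four [IsProbabilityMeasure μ] {E : Type*}
    [SeminormedAddCommGroup E] {f : Ω → E}
    {C : ℝ≥0∞} (h : ∫⁻ ω, ‖f ω‖ₑ ^ 4 ∂μ ≤ C) : ∫⁻ ω, ENNReal.ofReal (‖f ω‖ ^ 2) ∂μ ≤ 1 + C := by
  calc ∫⁻ ω, ENNReal.ofReal (‖f ω‖ ^ 2) ∂μ ≤ ∫⁻ ω, (1 + ‖f ω‖ₑ ^ 4) ∂μ := by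
        refine lintegral_mono fun ω => ?_
        rw [← ofReal_norm, ← ENNReal.ofReal_one, ← ENNReal.ofReal_pow (norm_nonneg _),
          ← ENNReal.ofReal_add zero_le_one (by positivity)]
        exact ENNReal.ofReal_le_ofReal (by nlinarith [sq_nonneg (‖f ω‖ ^ 2 - 1)])
    _ ≤ 1 + C := by
        rw [lintegral_add_left measurable_const]
        simpa using add_le_add_right h 1

theorem lintegral_ofReal_add_le {f g : Ω → ℝ} {A B : ℝ≥0∞} (hf : Measurable f)
    (hA : ∫⁻ ω, ENNReal.ofReal (f ω) ∂μ ≤ A) (hB : ∫⁻ ω, ENNReal.ofReal (g ω) ∂μ ≤ B) :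
    ∫⁻ ω, ENNReal.ofReal (f ω + g ω) ∂μ ≤ A + B := by
  refine (lintegral_mono fun ω => ENNReal.ofReal_add_le).trans ?_
  rw [lintegral_add_left hf.ennreal_ofReal]
  exact add_le_add hA hB

theorem lintegral_ofReal_const_mul_le {f : Ω → ℝ} {A : ℝ≥0∞} {c : ℝ} (hc : 0 ≤ c)
    (hf : Measurable f) (hA : ∫⁻ ω, ENNReal.ofReal (f ω) ∂μ ≤ A) :
    ∫⁻ ω, ENNReal.ofReal (c * f ω) ∂μ ≤ ENNReal.ofReal c * A := by
  simp_rw [ENNReal.ofReal_mul hc]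
  rw [lintegral_const_mul _ hf.ennreal_ofReal]
  gcongr

theorem lintegral_ofReal_average_le {a : ℕ} {f : Fin a → Ω → ℝ} {C : ℝ≥0∞}
    (hf : ∀ i, Measurable (f i)) (hC : ∀ i, ∫⁻ ω, ENNReal.ofReal (f i ω) ∂μ ≤ C) :
    ∫⁻ ω, ENNReal.ofReal ((1 / (a : ℝ)) * ∑ i, f i ω) ∂μ ≤ C := by
  have h : ∀ s : Finset (Fin a), ∫⁻ ω, ENNReal.ofReal (∑ i ∈ s, f i ω) ∂μ ≤ s.card * C := by
    intro s
    induction s using Finset.induction_on with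
    | empty => simp
    | insert i s hi ih =>
      simp only [Finset.sum_insert hi, Finset.card_insert_of_notMem hi]
      refine (lintegral_ofReal_add_le (hf i) (hC i) ih).trans_eq ?_
      push_cast
      ring
  refine (lintegral_ofReal_const_mul_le (by positivity)
    (Finset.measurable_sum _ fun i _ => hf i) (h Finset.univ)).trans ?_
  rcases Nat.eq_zero_or_pos a with rfl | ha
  · simp
  · rw [Finset.card_univ, Fintype.card_fin, ← mul_assoc]
    refine (mul_le_mul_left (le_of_eq ?_) C).trans_eq (one_mul C)
    rw [← ENNReal.ofReal_natCast, ← ENNReal.ofReal_mul (by positivity)]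
    have : (a : ℝ) ≠ 0 := by positivity
    simp [this]

end Moments

namespace Panel

variable {Ω : Type*} [MeasurableSpace Ω] {k r : ℕ}

/-- All entries of the model are random variables. -/
structure IsMeasurable (X : Panel Ω k r) : Prop where
  R : ∀ i l, Measurable fun ω => X.R ω i l
  C : ∀ m l, Measurable fun ω => X.C ω m l
  F : ∀ t l l', Measurable fun ω => X.F t ω l l'
  E : ∀ t i m, Measurable fun ω => X.E t ω i m
  W : ∀ t i m, Measurable fun ω => X.W t ω i m

namespace IsMeasurable

variable {X : Panel Ω k r}

theorem transpose (h : X.IsMeasurable) : X.transpose.IsMeasurable where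
  R := h.C
  C := h.R
  F := fun t l l' => h.F t l' l
  E := fun t i m => h.E t m i
  W := fun t i m => h.W t m i

theorem sum_Q (h : X.IsMeasurable) (i j : Fin X.a) {f : Fin X.T × Fin X.b → Ω → ℝ}
    (hf : ∀ p, Measurable (f p)) : Measurable fun ω => ∑ p ∈ X.Q i j ω, f p ω := by
  simp only [Q, Finset.sum_filter]
  refine Finset.measurable_sum _ fun p _ => Measurable.ite ?_ (hf p) measurable_const
  exact (h.W p.1 i p.2 (measurableSet_singleton true)).inter
    (h.W p.1 j p.2 (measurableSet_singleton true))

theorem N (h : X.IsMeasurable) (i j : Fin X.a) : Measurable (X.N i j) := by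
  have : X.N i j = fun ω => ∑ p ∈ X.Q i j ω, (fun _ _ => (1 : ℝ)) p ω := by
    funext ω
    simp [Panel.N]
  rw [this]
  exact h.sum_Q i j fun _ => measurable_const

theorem FC (h : X.IsMeasurable) (t : Fin X.T) (m : Fin X.b) (l : Fin k) :
    Measurable fun ω => X.FC ω t m l := by
  simp only [Panel.FC, Matrix.mulVec, dotProduct]
  exact Finset.measurable_sum _ fun l' _ => (h.F t l l').mul (h.C m l')

theorem factorErr (h : X.IsMeasurable) (i j i' : Fin X.a) (l : Fin k) :
    Measurable fun ω => X.factorErr ω i j i' l := by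
  simp only [Panel.factorErr, Finset.sum_apply, Pi.smul_apply, smul_eq_mul]
  exact h.sum_Q i j fun p => (h.E p.1 i' p.2).mul (h.FC p.1 p.2 l)

theorem S (h : X.IsMeasurable) (l m : Fin k) : Measurable fun ω => X.S ω l m := by
  simp only [Panel.S, Matrix.smul_apply, Matrix.sum_apply, Matrix.mul_apply,
    Matrix.transpose_apply, smul_eq_mul]
  have h1 := h.F
  have h2 := h.C
  fun_prop

theorem SQ (h : X.IsMeasurable) (i j : Fin X.a) (l m : Fin k) :
    Measurable fun ω => X.SQ ω i j l m := by
  simp only [Panel.SQ, Matrix.smul_apply, Matrix.sum_apply, Matrix.vecMulVec_apply, smul_eq_mul]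
  have h1 := h.sum_Q i j (f := fun p ω => X.FC ω p.1 p.2 l * X.FC ω p.1 p.2 m)
    fun p => (h.FC p.1 p.2 l).mul (h.FC p.1 p.2 m)
  have h2 := h.N i j
  exact (h2.const_div 1).mul h1

theorem centeredErr (h : X.IsMeasurable) (μ : Measure Ω) (i j : Fin X.a) :
    Measurable fun ω => X.centeredErr μ ω i j :=
  h.sum_Q i j fun p => ((h.E p.1 i p.2).mul (h.E p.1 j p.2)).sub measurable_const

theorem Mhat (h : X.IsMeasurable) (i j : Fin X.a) : Measurable fun ω => X.Mhat ω i j := by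
  have hY : ∀ t i m, Measurable fun ω => X.Y t ω i m := by
    intro t i m
    simp only [Y_apply, dotProduct]
    exact (Finset.measurable_sum _ fun l _ => (h.R i l).mul (h.FC t m l)).add (h.E t i m)
  simp only [Panel.Mhat, Matrix.of_apply]
  exact (((h.N i j).const_div 1).const_mul _).mul
    (h.sum_Q i j fun p => (hY p.1 i p.2).mul (hY p.1 j p.2))

end IsMeasurable

/-- The variable dominating the squared residual entry `(i, j)` after multiplication by `b T`:
a combination of the normalised quantities whose moments are bounded by assumption. -/
noncomputable def residBound (X : Panel Ω k r) (μ : Measure Ω) (M q : ℝ)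
    (SigFC : Matrix (Fin k) (Fin k) ℝ) (i j : Fin X.a) (ω : Ω) : ℝ :=
  10 * M ^ 4 / q * ‖√(X.N i j ω) • (X.SQ ω i j - SigFC)‖ ^ 2
  + (10 * M ^ 4 * ‖√(X.b * X.T : ℝ) • (X.S ω - SigFC)‖ ^ 2
  + (5 * M ^ 2 / q * ‖(WithLp.toLp 2 ((1 / √(X.N i j ω)) • X.factorErr ω i j j) :
      EuclideanSpace ℝ (Fin k))‖ ^ 2
  + (5 * M ^ 2 / q * ‖(WithLp.toLp 2 ((1 / √(X.N i j ω)) • X.factorErr ω i j i) :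
      EuclideanSpace ℝ (Fin k))‖ ^ 2
  + 5 / q * ‖(1 / √(X.N i j ω)) * X.centeredErr μ ω i j‖ ^ 2)))

theorem residBound_nonneg (X : Panel Ω k r) (μ : Measure Ω) (M : ℝ) {q : ℝ} (hq : 0 < q)
    (SigFC : Matrix (Fin k) (Fin k) ℝ) (i j : Fin X.a) (ω : Ω) :
    0 ≤ X.residBound μ M q SigFC i j ω := by
  unfold residBound
  positivity

theorem IsMeasurable.residBound {X : Panel Ω k r} (h : X.IsMeasurable) (μ : Measure Ω) (M q : ℝ)
    (SigFC : Matrix (Fin k) (Fin k) ℝ) (i j : Fin X.a) :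
    Measurable (X.residBound μ M q SigFC i j) := by
  have h1 : Measurable fun ω => ‖√(X.N i j ω) • (X.SQ ω i j - SigFC)‖ :=
    measurable_norm_of_entries fun l m => (h.N i j).sqrt.mul ((h.SQ i j l m).sub_const _)
  have h2 : Measurable fun ω => ‖√(X.b * X.T : ℝ) • (X.S ω - SigFC)‖ :=
    measurable_norm_of_entries fun l m => ((h.S l m).sub_const _).const_mul _
  have h3 : ∀ i', Measurable fun ω => ‖(WithLp.toLp 2 ((1 / √(X.N i j ω)) • X.factorErr ω i j i') :
      EuclideanSpace ℝ (Fin k))‖ := fun i' =>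
    (measurable_toLp_of_entries fun l =>
      ((h.N i j).sqrt.const_div 1).mul (h.factorErr i j i' l)).norm
  have h4 : Measurable fun ω => ‖(1 / √(X.N i j ω)) * X.centeredErr μ ω i j‖ :=
    (((h.N i j).sqrt.const_div 1).mul (h.centeredErr μ i j)).norm
  unfold Panel.residBound
  exact ((h1.pow_const 2).const_mul _).add (((h2.pow_const 2).const_mul _).add
    ((((h3 j).pow_const 2).const_mul _).add ((((h3 i).pow_const 2).const_mul _).add
      ((h4.pow_const 2).const_mul _))))

theorem IsMeasurable.lintegral_residBound_le {X : Panel Ω k r} (h : X.IsMeasurable)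
    {μ : Measure Ω} [IsProbabilityMeasure μ] (M : ℝ) {q : ℝ} (hq : 0 < q)
    {SigFC : Matrix (Fin k) (Fin k) ℝ} {i j : Fin X.a} {C : ℝ≥0∞}
    (hSQ : ∫⁻ ω, ‖√(X.N i j ω) • (X.SQ ω i j - SigFC)‖ₑ ^ 2 ∂μ ≤ C)
    (hS : ∫⁻ ω, ‖√(X.b * X.T : ℝ) • (X.S ω - SigFC)‖ₑ ^ 2 ∂μ ≤ C)
    (hr : ∫⁻ ω, ‖(WithLp.toLp 2 ((1 / √(X.N i j ω)) • X.factorErr ω i j j) :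
      EuclideanSpace ℝ (Fin k))‖ₑ ^ 4 ∂μ ≤ C)
    (hl : ∫⁻ ω, ‖(WithLp.toLp 2 ((1 / √(X.N i j ω)) • X.factorErr ω i j i) :
      EuclideanSpace ℝ (Fin k))‖ₑ ^ 4 ∂μ ≤ C)
    (hE : ∫⁻ ω, ‖(1 / √(X.N i j ω)) * X.centeredErr μ ω i j‖ₑ ^ 4 ∂μ ≤ C) :
    ∫⁻ ω, ENNReal.ofReal (X.residBound μ M q SigFC i j ω) ∂μ ≤
      ENNReal.ofReal (10 * M ^ 4 / q) * C + (ENNReal.ofReal (10 * M ^ 4) * C +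
        (ENNReal.ofReal (5 * M ^ 2 / q) * (1 + C) + (ENNReal.ofReal (5 * M ^ 2 / q) * (1 + C) +
          ENNReal.ofReal (5 / q) * (1 + C)))) := by
  have h1 : Measurable fun ω => ‖√(X.N i j ω) • (X.SQ ω i j - SigFC)‖ :=
    measurable_norm_of_entries fun l m => (h.N i j).sqrt.mul ((h.SQ i j l m).sub_const _)
  have h2 : Measurable fun ω => ‖√(X.b * X.T : ℝ) • (X.S ω - SigFC)‖ :=
    measurable_norm_of_entries fun l m => ((h.S l m).sub_const _).const_mul _
  have h3 : ∀ i', Measurable fun ω => ‖(WithLp.toLp 2 ((1 / √(X.N i j ω)) • X.factorErr ω i j i') :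
      EuclideanSpace ℝ (Fin k))‖ := fun i' =>
    (measurable_toLp_of_entries fun l =>
      ((h.N i j).sqrt.const_div 1).mul (h.factorErr i j i' l)).norm
  have h4 : Measurable fun ω => ‖(1 / √(X.N i j ω)) * X.centeredErr μ ω i j‖ :=
    (((h.N i j).sqrt.const_div 1).mul (h.centeredErr μ i j)).norm
  unfold Panel.residBound
  refine lintegral_ofReal_add_le ((h1.pow_const 2).const_mul _) (lintegral_ofReal_const_mul_le
    (by positivity) (h1.pow_const 2) (lintegral_ofReal_norm_sq_le_of_two hSQ)) ?_
  refine lintegral_ofReal_add_le ((h2.pow_const 2).const_mul _) (lintegral_ofReal_const_mul_le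
    (by positivity) (h2.pow_const 2) (lintegral_ofReal_norm_sq_le_of_two hS)) ?_
  refine lintegral_ofReal_add_le (((h3 j).pow_const 2).const_mul _) (lintegral_ofReal_const_mul_le
    (by positivity) ((h3 j).pow_const 2) (lintegral_ofReal_norm_sq_le_of_four hr)) ?_
  refine lintegral_ofReal_add_le (((h3 i).pow_const 2).const_mul _) (lintegral_ofReal_const_mul_le
    (by positivity) ((h3 i).pow_const 2) (lintegral_ofReal_norm_sq_le_of_four hl)) ?_
  exact lintegral_ofReal_const_mul_le
    (by positivity) (h4.pow_const 2) (lintegral_ofReal_norm_sq_le_of_four hE)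

theorem abs_dotProduct_le (x y : Fin k → ℝ) :
    |x ⬝ᵥ y| ≤ ‖(WithLp.toLp 2 x : EuclideanSpace ℝ (Fin k))‖ *
      ‖(WithLp.toLp 2 y : EuclideanSpace ℝ (Fin k))‖ := by
  have h : x ⬝ᵥ y = inner ℝ (WithLp.toLp 2 y : EuclideanSpace ℝ (Fin k)) (WithLp.toLp 2 x) := by
    simp [PiLp.inner_apply, dotProduct]
  rw [h, mul_comm]
  exact abs_real_inner_le_norm _ _

theorem resid_sq_le (X : Panel Ω k r) (μ : Measure Ω) {M q : ℝ} (hq : 0 < q)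
    (SigFC : Matrix (Fin k) (Fin k) ℝ) (ω : Ω) (i j : Fin X.a)
    (hβ : 0 < (X.b * X.T : ℝ)) (hN : q * (X.b * X.T) ≤ X.N i j ω)
    (hR : ∀ i, ‖(WithLp.toLp 2 (X.R ω i) : EuclideanSpace ℝ (Fin k))‖ ≤ M)
    {τ : ℝ} (hτ : |X.meanErr μ ω i j| ≤ τ) :
    X.resid ω i j ^ 2 ≤
      (1 / (X.b * X.T : ℝ)) * X.residBound μ M q SigFC i j ω + 5 * τ ^ 2 := by
  set β : ℝ := X.b * X.T with hβdef
  set N := X.N i j ω with hNdef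
  have hM : 0 ≤ M := (norm_nonneg _).trans (hR i)
  have hN0 : 0 < N := (mul_pos hq hβ).trans_le hN
  have hNinv : 1 / N ≤ 1 / (q * β) := one_div_le_one_div_of_le (mul_pos hq hβ) hN
  set f := X.factorErr ω i j with hf
  set n₁ := ‖√N • (X.SQ ω i j - SigFC)‖ with hn₁
  set n₂ := ‖√β • (X.S ω - SigFC)‖ with hn₂
  -- normalisation by `1 / N` costs a factor `1 / N ≤ 1 / (q b T)` in the square
  have hscale : ∀ x : ℝ, (1 / N * x) ^ 2 ≤ 1 / (q * β) * (1 / √N * x) ^ 2 := by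
    intro x
    have : (1 / N * x) ^ 2 = 1 / N * (1 / √N * x) ^ 2 := by
      rw [mul_pow, mul_pow, div_pow, div_pow, Real.sq_sqrt hN0.le]
      field_simp
    rw [this]
    gcongr
  have hnorm : ∀ (c : ℝ) (x : Fin k → ℝ), 0 ≤ c →
      ‖(WithLp.toLp 2 (c • x) : EuclideanSpace ℝ (Fin k))‖ =
        c * ‖(WithLp.toLp 2 x : EuclideanSpace ℝ (Fin k))‖ := by
    intro c x hc
    rw [WithLp.toLp_smul, norm_smul, Real.norm_of_nonneg hc]
  have b1 : (X.R ω i ⬝ᵥ ((X.SQ ω i j - X.S ω) *ᵥ X.R ω j)) ^ 2 ≤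
      M ^ 4 * (2 * (1 / (q * β) * n₁ ^ 2) + 2 * (1 / β * n₂ ^ 2)) := by
    have e1 : |X.R ω i ⬝ᵥ ((X.SQ ω i j - X.S ω) *ᵥ X.R ω j)| ≤
        M * (‖X.SQ ω i j - X.S ω‖ * M) := by
      refine (abs_dotProduct_le _ _).trans ?_
      gcongr
      · exact hR i
      · refine ((X.SQ ω i j - X.S ω).l2_opNorm_mulVec (WithLp.toLp 2 (X.R ω j))).trans ?_
        gcongr
        exact hR j
    have e2 : ‖X.SQ ω i j - X.S ω‖ ≤ ‖X.SQ ω i j - SigFC‖ + ‖X.S ω - SigFC‖ := by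
      rw [← sub_sub_sub_cancel_right _ _ SigFC]
      exact norm_sub_le _ _
    have e3 : ‖X.SQ ω i j - SigFC‖ ^ 2 ≤ 1 / (q * β) * n₁ ^ 2 := by
      rw [hn₁, norm_smul, Real.norm_of_nonneg (Real.sqrt_nonneg _), mul_pow, Real.sq_sqrt hN0.le,
        ← mul_assoc]
      refine le_mul_of_one_le_left (sq_nonneg _) ?_
      rw [one_div, ← div_eq_inv_mul, one_le_div (mul_pos hq hβ)]
      exact hN
    have e4 : ‖X.S ω - SigFC‖ ^ 2 = 1 / β * n₂ ^ 2 := by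
      rw [hn₂, norm_smul, Real.norm_of_nonneg (Real.sqrt_nonneg _), mul_pow, Real.sq_sqrt hβ.le]
      field_simp
    have e5 : ‖X.SQ ω i j - X.S ω‖ ^ 2 ≤
        2 * ‖X.SQ ω i j - SigFC‖ ^ 2 + 2 * ‖X.S ω - SigFC‖ ^ 2 := by
      have := pow_le_pow_left₀ (norm_nonneg _) e2 2
      nlinarith [sq_nonneg (‖X.SQ ω i j - SigFC‖ - ‖X.S ω - SigFC‖)]
    rw [← sq_abs]
    calc _ ≤ (M * (‖X.SQ ω i j - X.S ω‖ * M)) ^ 2 := by gcongr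
      _ = M ^ 4 * ‖X.SQ ω i j - X.S ω‖ ^ 2 := by ring
      _ ≤ _ := by
        gcongr
        linarith
  have b2 : ∀ l l', (X.R ω l ⬝ᵥ ((1 / N) • f l')) ^ 2 ≤
      M ^ 2 * (1 / (q * β) * ‖(WithLp.toLp 2 ((1 / √N) • f l') :
        EuclideanSpace ℝ (Fin k))‖ ^ 2) := by
    intro l l'
    rw [← sq_abs, hnorm _ _ (by positivity)]
    calc _ ≤ (M * (1 / N * ‖(WithLp.toLp 2 (f l') : EuclideanSpace ℝ (Fin k))‖)) ^ 2 := by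
          gcongr
          refine (abs_dotProduct_le _ _).trans ?_
          rw [hnorm _ _ (by positivity)]
          gcongr
          exact hR l
      _ = M ^ 2 * (1 / N * ‖(WithLp.toLp 2 (f l') : EuclideanSpace ℝ (Fin k))‖) ^ 2 := by ring
      _ ≤ _ := by
          gcongr
          exact hscale _
  have b3 : (1 / N * X.centeredErr μ ω i j) ^ 2 ≤
      1 / (q * β) * ‖1 / √N * X.centeredErr μ ω i j‖ ^ 2 := by
    have := hscale |X.centeredErr μ ω i j|
    rw [mul_pow, sq_abs, ← mul_pow] at this
    refine this.trans_eq ?_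
    rw [norm_mul, Real.norm_of_nonneg (by positivity : 0 ≤ 1 / √N), Real.norm_eq_abs]
  have b4 : X.meanErr μ ω i j ^ 2 ≤ τ ^ 2 := by
    rw [← sq_abs]
    gcongr
  rw [X.resid_apply μ, dotProduct_comm _ (X.R ω j)]
  have hsum : ∀ x₁ x₂ x₃ x₄ x₅ : ℝ, (x₁ + x₂ + x₃ + x₄ + x₅) ^ 2 ≤
      5 * (x₁ ^ 2 + x₂ ^ 2 + x₃ ^ 2 + x₄ ^ 2 + x₅ ^ 2) := by
    intro x₁ x₂ x₃ x₄ x₅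
    nlinarith [sq_nonneg (x₁ - x₂), sq_nonneg (x₁ - x₃), sq_nonneg (x₁ - x₄), sq_nonneg (x₁ - x₅),
      sq_nonneg (x₂ - x₃), sq_nonneg (x₂ - x₄), sq_nonneg (x₂ - x₅), sq_nonneg (x₃ - x₄),
      sq_nonneg (x₃ - x₅), sq_nonneg (x₄ - x₅)]
  refine (hsum _ _ _ _ _).trans ?_
  calc _ ≤ 5 * (M ^ 4 * (2 * (1 / (q * β) * n₁ ^ 2) + 2 * (1 / β * n₂ ^ 2))
        + M ^ 2 * (1 / (q * β) * ‖(WithLp.toLp 2 ((1 / √N) • f j) :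
          EuclideanSpace ℝ (Fin k))‖ ^ 2)
        + M ^ 2 * (1 / (q * β) * ‖(WithLp.toLp 2 ((1 / √N) • f i) :
          EuclideanSpace ℝ (Fin k))‖ ^ 2)
        + 1 / (q * β) * ‖1 / √N * X.centeredErr μ ω i j‖ ^ 2 + τ ^ 2) := by
        gcongr
        · exact b2 i j
        · exact b2 j i
    _ = _ := by
        rw [residBound]
        field_simp
        ring

end Panel

/-! ### Linear images of Gaussian vectors -/

theorem map_prod_multivariateGaussian {k : ℕ} {A B : Matrix (Fin k) (Fin k) ℝ}
    (hA : A.PosSemidef) (hB : B.PosSemidef) (G : Matrix (Fin k) (Fin k) ℝ) :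
    ((multivariateGaussian (0 : EuclideanSpace ℝ (Fin k)) A).prod
      (multivariateGaussian (0 : EuclideanSpace ℝ (Fin k)) B)).map
        (fun z => WithLp.toLp 2 (G *ᵥ (z.1 + z.2).ofLp)) =
      multivariateGaussian (0 : EuclideanSpace ℝ (Fin k)) (G * (A + B) * Gᵀ) := by
  have hAB : (A + B).PosSemidef := hA.add hB
  have hG : (G * (A + B) * Gᵀ).PosSemidef := by
    rw [← Matrix.conjTranspose_eq_transpose_of_trivial]
    exact hAB.mul_mul_conjTranspose_same G
  have hL : Continuous fun x : EuclideanSpace ℝ (Fin k) =>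
      (WithLp.toLp 2 (G *ᵥ x.ofLp) : EuclideanSpace ℝ (Fin k)) := by fun_prop
  have hconv : ((multivariateGaussian (0 : EuclideanSpace ℝ (Fin k)) A).prod
      (multivariateGaussian (0 : EuclideanSpace ℝ (Fin k)) B)).map
        (fun z => WithLp.toLp 2 (G *ᵥ (z.1 + z.2).ofLp)) =
      ((multivariateGaussian (0 : EuclideanSpace ℝ (Fin k)) A) ∗
        (multivariateGaussian (0 : EuclideanSpace ℝ (Fin k)) B)).map
        fun x => WithLp.toLp 2 (G *ᵥ x.ofLp) := by
    rw [Measure.conv, Measure.map_map hL.measurable (by fun_prop)]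
    rfl
  have : IsProbabilityMeasure (((multivariateGaussian (0 : EuclideanSpace ℝ (Fin k)) A) ∗
        (multivariateGaussian (0 : EuclideanSpace ℝ (Fin k)) B)).map
        fun x => (WithLp.toLp 2 (G *ᵥ x.ofLp) : EuclideanSpace ℝ (Fin k))) :=
    Measure.isProbabilityMeasure_map hL.measurable.aemeasurable
  rw [hconv]
  refine Measure.ext_of_charFun (funext fun t => ?_)
  have hmap : charFun (((multivariateGaussian (0 : EuclideanSpace ℝ (Fin k)) A) ∗
        (multivariateGaussian (0 : EuclideanSpace ℝ (Fin k)) B)).map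
        fun x => (WithLp.toLp 2 (G *ᵥ x.ofLp) : EuclideanSpace ℝ (Fin k))) t =
      charFun ((multivariateGaussian (0 : EuclideanSpace ℝ (Fin k)) A) ∗
        (multivariateGaussian (0 : EuclideanSpace ℝ (Fin k)) B))
        (WithLp.toLp 2 (Gᵀ *ᵥ t.ofLp)) := by
    rw [charFun_apply, charFun_apply, integral_map hL.measurable.aemeasurable
      (by fun_prop)]
    congr 1
    funext x
    congr 3
    have : t.ofLp ⬝ᵥ (G *ᵥ x.ofLp) = (Gᵀ *ᵥ t.ofLp) ⬝ᵥ x.ofLp := by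
      rw [Matrix.mulVec_transpose, Matrix.dotProduct_mulVec]
    simpa [PiLp.inner_apply, dotProduct] using! this
  rw [hmap, charFun_conv, charFun_multivariateGaussian hA, charFun_multivariateGaussian hB,
    charFun_multivariateGaussian hG, ← Complex.exp_add]
  congr 1
  have hq : t.ofLp ⬝ᵥ ((G * (A + B) * Gᵀ) *ᵥ t.ofLp) =
      (Gᵀ *ᵥ t.ofLp) ⬝ᵥ (A *ᵥ (Gᵀ *ᵥ t.ofLp)) + (Gᵀ *ᵥ t.ofLp) ⬝ᵥ (B *ᵥ (Gᵀ *ᵥ t.ofLp)) := by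
    rw [← dotProduct_add, ← Matrix.add_mulVec, ← Matrix.mulVec_mulVec, ← Matrix.mulVec_mulVec,
      Matrix.mulVec_transpose G t.ofLp, ← Matrix.dotProduct_mulVec]
  rw [hq]
  simp only [inner_zero_right]
  push_cast
  ring

/-! ### Consistency -/

theorem tendsto_zero_of_sq_le {α : Type*} {F : Filter α} {f g : α → ℝ}
    (h : ∀ᶠ x in F, f x ^ 2 ≤ g x) (hg : Tendsto g F (𝓝 0)) : Tendsto f F (𝓝 0) := by
  have hs : Tendsto (fun x => √(g x)) F (𝓝 0) := by
    have := (Real.continuous_sqrt.tendsto 0).comp hg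
    rwa [Real.sqrt_zero] at this
  exact squeeze_zero_norm' (h.mono fun x hx => Real.abs_le_sqrt hx) hs

/-- A sequence bounded in mean square, multiplied by constants tending to zero, tends to zero in
probability. -/
theorem tendsto_mul_norm_inProb_zero {Ω : Type*} [MeasurableSpace Ω] {μ : Measure Ω}
    {E : Type*} [SeminormedAddCommGroup E] {f : ℕ → Ω → E} {r : ℕ → ℝ} {C : ℝ≥0∞} (hC : C ≠ ∞)
    (hf : ∀ n, Measurable fun ω => ‖f n ω‖) (hint : ∀ n, ∫⁻ ω, ‖f n ω‖ₑ ^ 2 ∂μ ≤ C)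
    (hr : Tendsto r atTop (𝓝 0)) :
    Tendsto (fun p : ℕ × Ω => r p.1 * ‖f p.1 p.2‖) (inProb μ) (𝓝 0) := by
  have h := tendsto_mul_inProb_zero (μ := μ) (f := fun n ω => ‖f n ω‖ ^ 2) (r := fun n => r n ^ 2)
    hC (fun n => (hf n).pow_const 2) (fun n ω => sq_nonneg _)
    (fun n => lintegral_ofReal_norm_sq_le_of_two (hint n)) (by simpa using hr.pow 2)
  exact tendsto_zero_of_sq_le (Eventually.of_forall fun p => (mul_pow _ _ 2).le) h

/-- The part of the standing assumptions that concerns dimensions and measurability. -/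
structure IsRegularSequence {Ω : Type*} [MeasurableSpace Ω] {k r : ℕ} (X : ℕ → Panel Ω k r) :
    Prop where
  tendsto_a : Tendsto (fun n => (X n).a) atTop atTop
  tendsto_b : Tendsto (fun n => (X n).b) atTop atTop
  tendsto_T : Tendsto (fun n => (X n).T) atTop atTop
  measurable : ∀ n, (X n).IsMeasurable

theorem ModelAssumptions.isRegularSequence {Ω : Type*} [MeasurableSpace Ω] {k r : ℕ}
    {X : ℕ → Panel Ω k r} {μ : Measure Ω} {M : ℝ≥0} (h : ModelAssumptions X μ M) :
    IsRegularSequence X where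
  tendsto_a := h.tendsto_a
  tendsto_b := h.tendsto_b
  tendsto_T := h.tendsto_T
  measurable n := ⟨h.measurable_R n, h.measurable_C n, h.measurable_F n, h.measurable_E n,
    h.measurable_W n⟩

namespace IsRegularSequence

variable {Ω : Type*} [MeasurableSpace Ω] {k r : ℕ} {X : ℕ → Panel Ω k r}

theorem transpose (h : IsRegularSequence X) : IsRegularSequence fun n => (X n).transpose where
  tendsto_a := h.tendsto_b
  tendsto_b := h.tendsto_a
  tendsto_T := h.tendsto_T
  measurable n := (h.measurable n).transpose

theorem tendsto_cast_a (h : IsRegularSequence X) :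
    Tendsto (fun n => ((X n).a : ℝ)) atTop atTop :=
  tendsto_natCast_atTop_atTop.comp h.tendsto_a

theorem tendsto_bT (h : IsRegularSequence X) :
    Tendsto (fun n => ((X n).b * (X n).T : ℝ)) atTop atTop :=
  (tendsto_natCast_atTop_atTop.comp h.tendsto_b).atTop_mul_atTop₀
    (tendsto_natCast_atTop_atTop.comp h.tendsto_T)

end IsRegularSequence

namespace RowAssumptions

variable {Ω : Type*} [MeasurableSpace Ω] {μ : Measure Ω} {k r : ℕ}
  {X : ℕ → Panel Ω k r} {M : ℝ≥0} {q : ℝ} {SigR SigFC : Matrix (Fin k) (Fin k) ℝ}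

theorem exists_meanErr_l1_bound (h : RowAssumptions X μ M q SigR SigFC) (n : ℕ)
    (hb : 0 < ((X n).b * (X n).T : ℝ)) :
    ∃ τ : Fin (X n).a → Fin (X n).a → ℝ, (∀ ω i j, |(X n).meanErr μ ω i j| ≤ τ i j) ∧
      ∀ j, ∑ i, τ i j ≤ M := by
  obtain ⟨τ, h1, h2⟩ := h.cross_E n
  have hb' : (X n).b ≠ 0 := by
    rintro h0
    simp [h0] at hb
  have hT' : (X n).T ≠ 0 := by
    rintro h0
    simp [h0] at hb
  have h0 : ∀ i j, 0 ≤ τ i j := fun i j => (abs_nonneg _).trans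
    (h1 ⟨0, Nat.pos_of_ne_zero hT'⟩ i j ⟨0, Nat.pos_of_ne_zero hb'⟩)
  exact ⟨τ, fun ω i j => (X n).abs_meanErr_le μ ω i j (h0 i j) fun t m => h1 t i j m, h2⟩

theorem exists_meanErr_bound [IsProbabilityMeasure μ] (h : RowAssumptions X μ M q SigR SigFC)
    (n : ℕ) (hb : 0 < ((X n).b * (X n).T : ℝ)) :
    ∃ τ : Fin (X n).a → Fin (X n).a → ℝ, (∀ ω i j, |(X n).meanErr μ ω i j| ≤ τ i j) ∧
      ∀ j, ∑ i, τ i j ^ 2 ≤ (M : ℝ) ^ 2 := by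
  obtain ⟨τ, h1, h2⟩ := h.exists_meanErr_l1_bound n hb
  obtain ⟨ω⟩ := μ.nonempty_of_neZero
  have h0 : ∀ i j, 0 ≤ τ i j := fun i j => (abs_nonneg _).trans (h1 ω i j)
  refine ⟨τ, h1, fun j => ?_⟩
  calc ∑ i, τ i j ^ 2 ≤ (∑ i, τ i j) ^ 2 :=
        Finset.sum_sq_le_sq_sum_of_nonneg fun i _ => h0 i j
    _ ≤ _ := pow_le_pow_left₀ (Finset.sum_nonneg fun i _ => h0 i j) (h2 j) 2

theorem tendsto_gram (h : RowAssumptions X μ M q SigR SigFC) :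
    Tendsto (fun p : ℕ × Ω => (1 / ((X p.1).a : ℝ)) • (((X p.1).R p.2)ᵀ * (X p.1).R p.2))
      (inProb μ) (𝓝 SigR) :=
  (tendstoInMeasure_const_iff (E := Matrix (Fin k) (Fin k) ℝ)
    (f := fun n ω => (1 / ((X n).a : ℝ)) • (((X n).R ω)ᵀ * (X n).R ω)) (c := SigR)).1 h.tendsto_R

variable [IsProbabilityMeasure μ]

theorem eventually_good (h : RowAssumptions X μ M q SigR SigFC) (hX : IsRegularSequence X) :
    ∀ᶠ p in inProb μ, 0 < ((X p.1).b * (X p.1).T : ℝ) ∧ 0 < ((X p.1).a : ℝ) ∧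
      (∀ i j, q * ((X p.1).b * (X p.1).T) ≤ (X p.1).N i j p.2) ∧
      ∀ i, ‖(WithLp.toLp 2 ((X p.1).R p.2 i) : EuclideanSpace ℝ (Fin k))‖ ≤ M := by
  have e1 : ∀ᶠ p in inProb μ, 0 < ((X p.1).b * (X p.1).T : ℝ) :=
    tendsto_fst_inProb.eventually (hX.tendsto_bT.eventually_gt_atTop 0)
  have e2 : ∀ᶠ p in inProb μ, 0 < ((X p.1).a : ℝ) :=
    tendsto_fst_inProb.eventually (hX.tendsto_cast_a.eventually_gt_atTop 0)
  have e3 : ∀ᶠ p in inProb μ, ∀ i j, q * ((X p.1).b * (X p.1).T) ≤ (X p.1).N i j p.2 := by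
    rw [eventually_inProb]
    have hm : ∀ n, MeasurableSet {ω | ∀ i j, q * ((X n).b * (X n).T) ≤ (X n).N i j ω} := by
      intro n
      have := (hX.measurable n).N
      simp only [Set.ofPred_forall]
      exact MeasurableSet.iInter fun i => MeasurableSet.iInter fun j =>
        measurableSet_le measurable_const (this i j)
    have h2 := ENNReal.Tendsto.sub (tendsto_const_nhds (x := (1 : ℝ≥0∞))) h.card_Q
      (Or.inl ENNReal.one_ne_top)
    rw [tsub_self] at h2
    refine h2.congr fun n => ?_
    rw [← prob_compl_eq_one_sub (hm n)]
    rfl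
  have e4 : ∀ᶠ p in inProb μ, ∀ i,
      ‖(WithLp.toLp 2 ((X p.1).R p.2 i) : EuclideanSpace ℝ (Fin k))‖ ≤ M :=
    eventually_inProb_of_ae (P := fun n ω => ∀ i,
      ‖(WithLp.toLp 2 ((X n).R ω i) : EuclideanSpace ℝ (Fin k))‖ ≤ M)
      fun n => ae_all_iff.2 fun i => h.bound_R n i
  filter_upwards [e1, e2, e3, e4] with p h1 h2 h3 h4
  exact ⟨h1, h2, h3, h4⟩

theorem exists_lintegral_residBound_le (h : RowAssumptions X μ M q SigR SigFC)
    (hX : IsRegularSequence X) (hq : 0 < q) :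
    ∃ C : ℝ≥0∞, C ≠ ∞ ∧ ∀ n i j,
      ∫⁻ ω, ENNReal.ofReal ((X n).residBound μ M q SigFC i j ω) ∂μ ≤ C := by
  refine ⟨_, ?_, fun n i j => (hX.measurable n).lintegral_residBound_le M hq (h.moment_SQ n i j)
    (h.moment_S n) (h.moment_FE_right n i j) (h.moment_FE_left n i j) (h.moment_EE n i j)⟩
  finiteness

theorem tendsto_mul_colSqResid (h : RowAssumptions X μ M q SigR SigFC)
    (hX : IsRegularSequence X) (hq : 0 < q) (j : ∀ n, Fin (X n).a) {s : ℕ → ℝ}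
    (hs : ∀ n, 0 ≤ s n) (hs₁ : Tendsto (fun n => s n / ((X n).b * (X n).T)) atTop (𝓝 0))
    (hs₂ : Tendsto (fun n => s n / (X n).a) atTop (𝓝 0)) :
    Tendsto (fun p : ℕ × Ω => s p.1 * (X p.1).colSqResid p.2 (j p.1)) (inProb μ) (𝓝 0) := by
  obtain ⟨C, hC, hint⟩ := h.exists_lintegral_residBound_le hX hq
  have t1 := tendsto_mul_inProb_zero (μ := μ)
    (f := fun n ω => (1 / ((X n).a : ℝ)) * ∑ i, (X n).residBound μ M q SigFC i (j n) ω) hC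
    (fun n => (Finset.measurable_sum _ fun i _ =>
      (hX.measurable n).residBound μ M q SigFC i (j n)).const_mul _)
    (fun n ω => mul_nonneg (by positivity) (Finset.sum_nonneg fun i _ =>
      (X n).residBound_nonneg μ M hq SigFC i (j n) ω))
    (fun n => lintegral_ofReal_average_le
      (fun i => (hX.measurable n).residBound μ M q SigFC i (j n)) fun i => hint n i (j n)) hs₁
  have t2 := (hs₂.const_mul (5 * (M : ℝ) ^ 2)).comp (tendsto_fst_inProb (μ := μ))
  have t3 := t1.add t2
  rw [mul_zero, add_zero] at t3
  refine squeeze_zero' (Eventually.of_forall fun p => mul_nonneg (hs _)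
    ((X p.1).colSqResid_nonneg _ _)) ?_ t3
  filter_upwards [h.eventually_good hX] with p ⟨hb, ha, hN, hR⟩
  obtain ⟨τ, hτ, hτ2⟩ := h.exists_meanErr_bound p.1 hb
  have hsum : ∑ i, (X p.1).resid p.2 i (j p.1) ^ 2 ≤
      (1 / ((X p.1).b * (X p.1).T : ℝ)) * ∑ i, (X p.1).residBound μ M q SigFC i (j p.1) p.2
        + 5 * (M : ℝ) ^ 2 := by
    calc _ ≤ ∑ i, ((1 / ((X p.1).b * (X p.1).T : ℝ)) *
          (X p.1).residBound μ M q SigFC i (j p.1) p.2 + 5 * τ i (j p.1) ^ 2) :=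
          Finset.sum_le_sum fun i _ => (X p.1).resid_sq_le μ hq SigFC p.2 i (j p.1) hb
            (hN i (j p.1)) hR (hτ p.2 i (j p.1))
      _ ≤ _ := by
          rw [Finset.sum_add_distrib, ← Finset.mul_sum, ← Finset.mul_sum]
          gcongr
          exact hτ2 (j p.1)
  calc _ ≤ s p.1 * ((1 / ((X p.1).a : ℝ)) * ((1 / ((X p.1).b * (X p.1).T : ℝ)) *
        ∑ i, (X p.1).residBound μ M q SigFC i (j p.1) p.2 + 5 * (M : ℝ) ^ 2)) := by
        rw [Panel.colSqResid]
        have := hs p.1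
        gcongr
    _ = _ := by
        simp only [Function.comp_apply]
        ring

theorem tendsto_mul_meanSqResid (h : RowAssumptions X μ M q SigR SigFC)
    (hX : IsRegularSequence X) (hq : 0 < q) {s : ℕ → ℝ}
    (hs : ∀ n, 0 ≤ s n) (hs₁ : Tendsto (fun n => s n / ((X n).b * (X n).T)) atTop (𝓝 0))
    (hs₂ : Tendsto (fun n => s n / (X n).a) atTop (𝓝 0)) :
    Tendsto (fun p : ℕ × Ω => s p.1 * (X p.1).meanSqResid p.2) (inProb μ) (𝓝 0) := by
  obtain ⟨C, hC, hint⟩ := h.exists_lintegral_residBound_le hX hq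
  have hm : ∀ n j, Measurable fun ω => (1 / ((X n).a : ℝ)) *
      ∑ i, (X n).residBound μ M q SigFC i j ω := fun n j =>
    (Finset.measurable_sum _ fun i _ => (hX.measurable n).residBound μ M q SigFC i j).const_mul _
  have t1 := tendsto_mul_inProb_zero (μ := μ)
    (f := fun n ω => (1 / ((X n).a : ℝ)) * ∑ j, (1 / ((X n).a : ℝ)) *
      ∑ i, (X n).residBound μ M q SigFC i j ω) hC
    (fun n => (Finset.measurable_sum _ fun j _ => hm n j).const_mul _)
    (fun n ω => mul_nonneg (by positivity) (Finset.sum_nonneg fun j _ => mul_nonneg (by positivity)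
      (Finset.sum_nonneg fun i _ => (X n).residBound_nonneg μ M hq SigFC i j ω)))
    (fun n => lintegral_ofReal_average_le (hm n) fun j => lintegral_ofReal_average_le
      (fun i => (hX.measurable n).residBound μ M q SigFC i j) fun i => hint n i j) hs₁
  have t2 := (hs₂.const_mul (5 * (M : ℝ) ^ 2)).comp (tendsto_fst_inProb (μ := μ))
  have t3 := t1.add t2
  rw [mul_zero, add_zero] at t3
  refine squeeze_zero' (Eventually.of_forall fun p => mul_nonneg (hs _)
    ((X p.1).meanSqResid_nonneg _)) ?_ t3
  filter_upwards [h.eventually_good hX] with p ⟨hb, ha, hN, hR⟩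
  obtain ⟨τ, hτ, hτ2⟩ := h.exists_meanErr_bound p.1 hb
  have hsum : ∀ j, ∑ i, (X p.1).resid p.2 i j ^ 2 ≤
      (1 / ((X p.1).b * (X p.1).T : ℝ)) * ∑ i, (X p.1).residBound μ M q SigFC i j p.2
        + 5 * (M : ℝ) ^ 2 := by
    intro j
    calc _ ≤ ∑ i, ((1 / ((X p.1).b * (X p.1).T : ℝ)) *
          (X p.1).residBound μ M q SigFC i j p.2 + 5 * τ i j ^ 2) :=
          Finset.sum_le_sum fun i _ => (X p.1).resid_sq_le μ hq SigFC p.2 i j hb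
            (hN i j) hR (hτ p.2 i j)
      _ ≤ _ := by
          rw [Finset.sum_add_distrib, ← Finset.mul_sum, ← Finset.mul_sum]
          gcongr
          exact hτ2 j
  calc _ ≤ s p.1 * ((1 / ((X p.1).a : ℝ) ^ 2) * ∑ j, ((1 / ((X p.1).b * (X p.1).T : ℝ)) *
        ∑ i, (X p.1).residBound μ M q SigFC i j p.2 + 5 * (M : ℝ) ^ 2)) := by
        rw [Panel.meanSqResid, Finset.sum_comm]
        have := hs p.1
        gcongr with j
        exact hsum j
    _ = _ := by
        simp only [Function.comp_apply]
        simp only [Finset.sum_add_distrib, ← Finset.mul_sum, Finset.sum_const,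
          Finset.card_univ, Fintype.card_fin, nsmul_eq_mul]
        field_simp

theorem tendsto_meanSqResid (h : RowAssumptions X μ M q SigR SigFC)
    (hX : IsRegularSequence X) (hq : 0 < q) :
    Tendsto (fun p : ℕ × Ω => (X p.1).meanSqResid p.2) (inProb μ) (𝓝 0) := by
  simpa using h.tendsto_mul_meanSqResid hX hq (s := fun _ => 1) (fun _ => zero_le_one)
    (by simp only [one_div]; exact hX.tendsto_bT.inv_tendsto_atTop)
    (by simp only [one_div]; exact hX.tendsto_cast_a.inv_tendsto_atTop)

theorem tendsto_S (h : RowAssumptions X μ M q SigR SigFC) (hX : IsRegularSequence X) :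
    Tendsto (fun p : ℕ × Ω => (X p.1).S p.2) (inProb μ) (𝓝 SigFC) := by
  rw [tendsto_iff_norm_sub_tendsto_zero]
  have t := tendsto_mul_norm_inProb_zero (μ := μ)
    (f := fun n ω => √((X n).b * (X n).T : ℝ) • ((X n).S ω - SigFC))
    (r := fun n => (√((X n).b * (X n).T : ℝ))⁻¹) ENNReal.coe_ne_top
    (fun n => measurable_norm_of_entries fun l m =>
      (((hX.measurable n).S l m).sub_const _).const_mul _)
    h.moment_S (Real.tendsto_sqrt_atTop.comp hX.tendsto_bT).inv_tendsto_atTop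
  refine t.congr' ?_
  filter_upwards [h.eventually_good hX] with p ⟨hb, _⟩
  have : √((X p.1).b * (X p.1).T : ℝ) ≠ 0 := (Real.sqrt_pos.2 hb).ne'
  rw [norm_smul, Real.norm_of_nonneg (Real.sqrt_nonneg _)]
  field_simp

variable {d : Fin k → ℝ} {Q : Matrix (Fin k) (Fin k) ℝ}
  {Rhat : ∀ n, Ω → Matrix (Fin (X n).a) (Fin k) ℝ}

theorem exists_eventually_le_eigval (h : RowAssumptions X μ M q SigR SigFC)
    (hX : IsRegularSequence X) (hq : 0 < q) (hQ : IsLimitRotation SigR SigFC d Q)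
    (hE : IsAlignedEstimator X μ Q Rhat) :
    ∃ c > 0, ∀ᶠ p in inProb μ, ∀ l, c ≤ (X p.1).eigval p.2 l := by
  have hW := h.tendsto_gram
  have hξ : Tendsto (fun p : ℕ × Ω => √((X p.1).meanSqResid p.2)) (inProb μ) (𝓝 0) := by
    have := (Real.continuous_sqrt.tendsto 0).comp (h.tendsto_meanSqResid hX hq)
    rwa [Real.sqrt_zero] at this
  have hlim := ((hW.mul (h.tendsto_S hX)).mul hW).sub (hξ.smul hW)
  rw [zero_smul, sub_zero] at hlim
  have hpd : (SigR * SigFC * SigR).PosDef := by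
    have := hQ.2.1.conjTranspose_mul_mul_same
      (Matrix.mulVec_injective_of_isUnit hQ.1.isUnit)
    rwa [hQ.1.isHermitian.eq] at this
  obtain ⟨c₁, hc₁, h₁⟩ := hpd.eventually_pos_mul_le hlim
  obtain ⟨c₂, hc₂, h₂⟩ := hQ.1.eventually_pos_mul_le hW
  have hK : 0 < ‖SigR‖ + 1 := by positivity
  refine ⟨c₁ / (‖SigR‖ + 1), by positivity, ?_⟩
  filter_upwards [h₁, h₂, hW.norm.eventually_lt_const (lt_add_one _),
    eventually_inProb_of_ae hE.isEstimator] with p hp₁ hp₂ hp₃ hp₄ l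
  refine hp₄.le_eigval hc₂ hp₂ (fun y => ?_) l
  have e1 := hp₁ y
  have e2 := (abs_le.1 (Matrix.abs_dotProduct_mulVec_le
    ((1 / ((X p.1).a : ℝ)) • (((X p.1).R p.2)ᵀ * (X p.1).R p.2)) y)).2
  have e3 : 0 ≤ y ⬝ᵥ y := Finset.sum_nonneg fun i _ => mul_self_nonneg _
  rw [Matrix.sub_mulVec, dotProduct_sub, Matrix.smul_mulVec, dotProduct_smul, smul_eq_mul] at e1
  have e4 : c₁ / (‖SigR‖ + 1) *
      (y ⬝ᵥ (((1 / ((X p.1).a : ℝ)) • (((X p.1).R p.2)ᵀ * (X p.1).R p.2)) *ᵥ y)) ≤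
      c₁ * (y ⬝ᵥ y) := by
    calc _ ≤ c₁ / (‖SigR‖ + 1) * ((‖SigR‖ + 1) * (y ⬝ᵥ y)) := by
          gcongr
          exact e2.trans (by gcongr)
      _ = _ := by field_simp
  rw [add_mul]
  linarith

/-- The normalised cross product of true and estimated loadings, and the eigenvalues, solve the
limiting normal equations up to errors of the size of the residual, hence converge. -/
theorem tendsto_cross_eigval (h : RowAssumptions X μ M q SigR SigFC)
    (hX : IsRegularSequence X) (hq : 0 < q) (hQ : IsLimitRotation SigR SigFC d Q)
    (hE : IsAlignedEstimator X μ Q Rhat) :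
    Tendsto (fun p : ℕ × Ω => ((1 / ((X p.1).a : ℝ)) • (((X p.1).R p.2)ᵀ * Rhat p.1 p.2),
      (X p.1).eigval p.2)) (inProb μ) (𝓝 (SigFC⁻¹ * Q⁻¹ * Matrix.diagonal d, d)) := by
  have hW := h.tendsto_gram
  have hξ : Tendsto (fun p : ℕ × Ω => √((X p.1).meanSqResid p.2)) (inProb μ) (𝓝 0) := by
    have := (Real.continuous_sqrt.tendsto 0).comp (h.tendsto_meanSqResid hX hq)
    rwa [Real.sqrt_zero] at this
  have hest := eventually_inProb_of_ae hE.isEstimator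
  obtain ⟨c, hc, hcv⟩ := h.exists_eventually_le_eigval hX hq hQ hE
  refine hQ.tendsto (B := √(‖SigR‖ + 1)) hW (h.tendsto_S hX)
    (E₁ := fun p => (1 / ((X p.1).a : ℝ) ^ 2) •
      (((X p.1).R p.2)ᵀ * (X p.1).resid p.2 * Rhat p.1 p.2))
    (E₂ := fun p => (1 / ((X p.1).a : ℝ) ^ 2) •
      ((Rhat p.1 p.2)ᵀ * (X p.1).resid p.2 * Rhat p.1 p.2)) ?_ ?_ ?_ ?_ hc hcv ?_ ?_ ?_
  · have t := ((Real.continuous_sqrt.tendsto _).comp hW.norm).mul hξ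
    rw [mul_zero] at t
    exact squeeze_zero_norm' (hest.mono fun p hp => hp.norm_resid_left_le) t
  · exact squeeze_zero_norm' (hest.mono fun p hp => hp.norm_resid_right_le) hξ
  · filter_upwards [hest, hW.norm.eventually_lt_const (lt_add_one _)] with p hp hp2
    exact Real.le_sqrt_of_sq_le (hp.norm_cross_sq_le.trans hp2.le)
  · exact hest.mono fun p hp => (X p.1).antitone_eigval p.2 hp.le_a
  · exact hest.mono fun p hp => hp.normal_eq_left
  · exact hest.mono fun p hp => hp.normal_eq_right
  · filter_upwards [eventually_inProb_of_ae hE.sign] with p hp l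
    have h1 : ((1 / ((X p.1).a : ℝ)) • (((X p.1).R p.2)ᵀ * Rhat p.1 p.2))ᵀ * Q⁻¹ =
        (1 / ((X p.1).a : ℝ)) • ((Rhat p.1 p.2)ᵀ * ((X p.1).R p.2 * Q⁻¹)) := by
      simp only [Matrix.transpose_smul, Matrix.transpose_mul, Matrix.transpose_transpose,
        Matrix.smul_mul, Matrix.mul_assoc]
    rw [h1, Matrix.smul_apply, smul_eq_mul]
    exact mul_nonneg (by positivity) (hp l)

theorem tendsto_eigval (h : RowAssumptions X μ M q SigR SigFC)
    (hX : IsRegularSequence X) (hq : 0 < q) (hQ : IsLimitRotation SigR SigFC d Q)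
    (hE : IsAlignedEstimator X μ Q Rhat) :
    Tendsto (fun p : ℕ × Ω => (X p.1).eigval p.2) (inProb μ) (𝓝 d) :=
  (continuous_snd.tendsto _).comp (h.tendsto_cross_eigval hX hq hQ hE)

theorem tendsto_inv_eigval (h : RowAssumptions X μ M q SigR SigFC)
    (hX : IsRegularSequence X) (hq : 0 < q) (hQ : IsLimitRotation SigR SigFC d Q)
    (hE : IsAlignedEstimator X μ Q Rhat) (l : Fin k) :
    Tendsto (fun p : ℕ × Ω => ((X p.1).eigval p.2 l)⁻¹) (inProb μ) (𝓝 (d l)⁻¹) :=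
  (tendsto_pi_nhds.1 (h.tendsto_eigval hX hq hQ hE) l).inv₀ (hQ.pos l).ne'

theorem tendsto_H (h : RowAssumptions X μ M q SigR SigFC)
    (hX : IsRegularSequence X) (hq : 0 < q) (hQ : IsLimitRotation SigR SigFC d Q)
    (hE : IsAlignedEstimator X μ Q Rhat) :
    Tendsto (fun p : ℕ × Ω => (X p.1).H p.2 (Rhat p.1 p.2)) (inProb μ) (𝓝 Q⁻¹) := by
  obtain ⟨c, hc, hcv⟩ := h.exists_eventually_le_eigval hX hq hQ hE
  have hZ := (continuous_fst.tendsto _).comp (h.tendsto_cross_eigval hX hq hQ hE)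
  have hV : Tendsto (fun p : ℕ × Ω => Matrix.diagonal fun l => ((X p.1).eigval p.2 l)⁻¹)
      (inProb μ) (𝓝 (Matrix.diagonal fun l => (d l)⁻¹)) :=
    ((continuous_id.matrix_diagonal).tendsto _).comp
      (tendsto_pi_nhds.2 fun l => h.tendsto_inv_eigval hX hq hQ hE l)
  have t := ((h.tendsto_S hX).mul hZ).mul hV
  have hlim : SigFC * (SigFC⁻¹ * Q⁻¹ * Matrix.diagonal d) * (Matrix.diagonal fun l => (d l)⁻¹) =
      Q⁻¹ := by
    rw [mul_assoc SigFC⁻¹, Matrix.mul_nonsing_inv_cancel_left _ _ hQ.isUnit_det_right, mul_assoc,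
      Matrix.diagonal_mul_diagonal]
    simp [(hQ.pos _).ne']
  rw [hlim] at t
  refine t.congr' ?_
  filter_upwards [hcv] with p hp
  have hinv : (Matrix.diagonal ((X p.1).eigval p.2))⁻¹ =
      Matrix.diagonal fun l => ((X p.1).eigval p.2 l)⁻¹ := by
    refine Matrix.inv_eq_left_inv ?_
    rw [Matrix.diagonal_mul_diagonal]
    simp [(hc.trans_le (hp _)).ne']
  rw [Panel.H_eq, hinv]
  rfl

end RowAssumptions

/-! ### The limit distribution -/

namespace Panel

variable {Ω : Type*} [MeasurableSpace Ω] {k r : ℕ}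

theorem IsMeasurable.aemeasurable_eigval {X : Panel Ω k r} (h : X.IsMeasurable) {μ : Measure Ω}
    {Rhat : Ω → Matrix (Fin X.a) (Fin k) ℝ} (hm : ∀ i l, Measurable fun ω => Rhat ω i l)
    (hE : ∀ᵐ ω ∂μ, X.IsEstimator ω (Rhat ω)) (l : Fin k) :
    AEMeasurable (fun ω => X.eigval ω l) μ := by
  have hmeas : Measurable fun ω => ((1 / (X.a : ℝ)) • ((Rhat ω)ᵀ * (X.Mhat ω * Rhat ω))) l l := by
    simp only [Matrix.smul_apply, Matrix.mul_apply, Matrix.transpose_apply, smul_eq_mul]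
    have := h.Mhat
    fun_prop
  refine hmeas.aemeasurable.congr ?_
  filter_upwards [hE] with ω hω
  rw [hω.2, ← Matrix.mul_assoc, ← Matrix.smul_mul, hω.1, Matrix.one_mul,
    Matrix.diagonal_apply_eq]

theorem IsMeasurable.aemeasurable_H {X : Panel Ω k r} (h : X.IsMeasurable) {μ : Measure Ω}
    {Rhat : Ω → Matrix (Fin X.a) (Fin k) ℝ} (hm : ∀ i l, Measurable fun ω => Rhat ω i l)
    (hE : ∀ᵐ ω ∂μ, X.IsEstimator ω (Rhat ω)) (l m : Fin k) :
    AEMeasurable (fun ω => X.H ω (Rhat ω) l m) μ := by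
  have hv := h.aemeasurable_eigval hm hE
  have hinv : ∀ l m, AEMeasurable (fun ω => (Matrix.diagonal (X.eigval ω))⁻¹ l m) μ := by
    intro l m
    simp only [Matrix.inv_def, Matrix.adjugate_diagonal, Matrix.det_diagonal,
      Ring.inverse_eq_inv', Matrix.smul_apply, smul_eq_mul, Matrix.diagonal_apply]
    refine AEMeasurable.mul (Finset.aemeasurable_fun_prod _ fun i _ => hv i).inv ?_
    split_ifs
    · exact Finset.aemeasurable_fun_prod _ fun i _ => hv i
    · exact aemeasurable_const
  have hZ : ∀ l m, Measurable fun ω => ((1 / (X.a : ℝ)) • ((X.R ω)ᵀ * Rhat ω)) l m := by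
    intro l m
    simp only [Matrix.smul_apply, Matrix.mul_apply, Matrix.transpose_apply, smul_eq_mul]
    exact (Finset.measurable_sum _ fun i _ => (h.R i l).mul (hm i m)).const_mul _
  have hSZ : ∀ l m, Measurable fun ω =>
      (X.S ω * ((1 / (X.a : ℝ)) • ((X.R ω)ᵀ * Rhat ω))) l m := by
    intro l m
    simp only [Matrix.mul_apply (M := X.S _)]
    exact Finset.measurable_sum _ fun i _ => (h.S l i).mul (hZ i m)
  simp only [H_eq]
  simp only [Matrix.mul_apply (N := (Matrix.diagonal (X.eigval _))⁻¹)]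
  exact Finset.aemeasurable_fun_sum _ fun i _ => (hSZ l i).aemeasurable.mul (hinv i m)

theorem IsMeasurable.aemeasurable_err {X : Panel Ω k r} (h : X.IsMeasurable) {μ : Measure Ω}
    {Rhat : Ω → Matrix (Fin X.a) (Fin k) ℝ} (hm : ∀ i l, Measurable fun ω => Rhat ω i l)
    (hE : ∀ᵐ ω ∂μ, X.IsEstimator ω (Rhat ω)) (j : Fin X.a) :
    AEMeasurable (fun ω => X.err ω (Rhat ω) j) μ := by
  have hH := h.aemeasurable_H hm hE
  have h1 := h.R
  unfold Panel.err
  refine (WithLp.measurable_toLp 2 _).comp_aemeasurable (aemeasurable_pi_lambda _ fun l => ?_)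
  simp only [Pi.sub_apply, Matrix.mulVec, dotProduct, Matrix.transpose_apply]
  fun_prop

/-- The `j`-th residual column averaged against the loadings is the sum of the two leading terms,
of two remainders with a spare factor `1 / √a`, and of a remainder from the noise covariances. -/
theorem resid_column_decomp (X : Panel Ω k r) (μ : Measure Ω) (ω : Ω) (j : Fin X.a) (m : Fin k) :
    √(X.b * X.T : ℝ) * ((1 / (X.a : ℝ)) * ∑ i, X.resid ω i j * X.R ω i m) =
      X.obsTerm ω j m + X.missTerm ω j m
      + (1 / √X.a) * ((√(X.b * X.T / X.a : ℝ) • ∑ i, (1 / X.N i j ω) •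
          Matrix.vecMulVec (X.R ω i) (X.factorErr ω i j i)) *ᵥ X.R ω j) m
      + (1 / √X.a) * (√(X.b * X.T / X.a : ℝ) •
          ∑ i, ((1 / X.N i j ω) * X.centeredErr μ ω i j) • X.R ω i) m
      + √(X.b * X.T : ℝ) / X.a * ∑ i, X.meanErr μ ω i j * X.R ω i m := by
  have ha : (0 : ℝ) < X.a := by
    have := j.pos
    positivity
  have hs : √(X.b * X.T / X.a : ℝ) = √(X.b * X.T : ℝ) / √X.a := Real.sqrt_div' _ ha.le
  have hc : ∀ y : ℝ, 1 / √(X.a : ℝ) * (√(X.b * X.T : ℝ) / √X.a * y) =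
      √(X.b * X.T : ℝ) / X.a * y := by
    intro y
    have h2 := Real.mul_self_sqrt ha.le
    rw [← mul_assoc, div_mul_div_comm, h2, one_mul]
  have h1 : (X.obsTerm ω j) m = √(X.b * X.T : ℝ) / X.a *
      ∑ i, (X.R ω i ⬝ᵥ ((1 / X.N i j ω) • X.factorErr ω i j j)) * X.R ω i m := by
    simp only [obsTerm, Pi.smul_apply, Finset.sum_apply, smul_eq_mul, Matrix.vecMulVec_mulVec]
    congr 1
    exact Finset.sum_congr rfl fun i _ => by rw [op_smul_eq_smul, smul_eq_mul]
  have h2 : (X.missTerm ω j) m = √(X.b * X.T : ℝ) / X.a *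
      ∑ i, (X.R ω i ⬝ᵥ ((X.SQ ω i j - X.S ω) *ᵥ X.R ω j)) * X.R ω i m := by
    simp only [missTerm, Pi.smul_apply, Finset.sum_apply, smul_eq_mul, ← Matrix.mulVec_mulVec,
      Matrix.vecMulVec_mulVec]
    congr 1
    exact Finset.sum_congr rfl fun i _ => by rw [op_smul_eq_smul, smul_eq_mul]
  have h3 : ((√(X.b * X.T / X.a : ℝ) • ∑ i, (1 / X.N i j ω) •
          Matrix.vecMulVec (X.R ω i) (X.factorErr ω i j i)) *ᵥ X.R ω j) m =
      √(X.b * X.T : ℝ) / √X.a *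
      ∑ i, (((1 / X.N i j ω) • X.factorErr ω i j i) ⬝ᵥ X.R ω j) * X.R ω i m := by
    rw [hs, Matrix.smul_mulVec, Matrix.sum_mulVec]
    simp only [Pi.smul_apply, Finset.sum_apply, smul_eq_mul, Matrix.smul_mulVec,
      Matrix.vecMulVec_mulVec, smul_dotProduct]
    congr 1
    refine Finset.sum_congr rfl fun i _ => ?_
    simp
    ring
  have h4 : (√(X.b * X.T / X.a : ℝ) •
          ∑ i, ((1 / X.N i j ω) * X.centeredErr μ ω i j) • X.R ω i) m =
      √(X.b * X.T : ℝ) / √X.a *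
      ∑ i, ((1 / X.N i j ω) * X.centeredErr μ ω i j) * X.R ω i m := by
    rw [hs]
    simp only [Pi.smul_apply, Finset.sum_apply, smul_eq_mul]
  rw [h1, h2, h3, h4, hc, hc, ← mul_assoc, mul_one_div, ← mul_add, ← mul_add, ← mul_add,
    ← mul_add]
  congr 1
  simp only [← Finset.sum_add_distrib, ← add_mul]
  exact Finset.sum_congr rfl fun i _ => by rw [X.resid_apply μ]; ring

end Panel

theorem abs_apply_le_norm_toLp {k : ℕ} (x : Fin k → ℝ) (m : Fin k) :
    |x m| ≤ ‖(WithLp.toLp 2 x : EuclideanSpace ℝ (Fin k))‖ :=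
  PiLp.norm_apply_le (WithLp.toLp 2 x : EuclideanSpace ℝ (Fin k)) m

namespace RowAssumptions

variable {Ω : Type*} [MeasurableSpace Ω] {μ : Measure Ω} [IsProbabilityMeasure μ] {k r : ℕ}
  {X : ℕ → Panel Ω k r} {M : ℝ≥0} {q : ℝ} {SigR SigFC : Matrix (Fin k) (Fin k) ℝ}
  {d : Fin k → ℝ} {Q : Matrix (Fin k) (Fin k) ℝ}
  {Rhat : ∀ n, Ω → Matrix (Fin (X n).a) (Fin k) ℝ}
  {j : ∀ n, Fin (X n).a} {Gobs Gmiss : Matrix (Fin k) (Fin k) ℝ}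

/-- The residual column averaged against the true loadings is asymptotically equal to the sum of
the two leading terms. -/
theorem tendsto_resid_column (h : RowAssumptions X μ M q SigR SigFC)
    (hX : IsRegularSequence X) (hC : RowCLT X μ M j Gobs Gmiss)
    (hrate : Tendsto (fun n => √((X n).b * (X n).T : ℝ) / (X n).a) atTop (𝓝 0)) (m : Fin k) :
    Tendsto (fun p : ℕ × Ω => √((X p.1).b * (X p.1).T : ℝ) * ((1 / ((X p.1).a : ℝ)) *
        ∑ i, (X p.1).resid p.2 i (j p.1) * (X p.1).R p.2 i m) -
      ((X p.1).obsTerm p.2 (j p.1) m + (X p.1).missTerm p.2 (j p.1) m)) (inProb μ) (𝓝 0) := by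
  have hr : Tendsto (fun n => 1 / √((X n).a : ℝ)) atTop (𝓝 0) := by
    simp only [one_div]
    exact (Real.tendsto_sqrt_atTop.comp hX.tendsto_cast_a).inv_tendsto_atTop
  have t1 := tendsto_mul_norm_inProb_zero (μ := μ)
    (f := fun n ω => √((X n).b * (X n).T / (X n).a : ℝ) • ∑ i, (1 / (X n).N i (j n) ω) •
      Matrix.vecMulVec ((X n).R ω i) ((X n).factorErr ω i (j n) i)) ENNReal.coe_ne_top
    (fun n => measurable_norm_of_entries fun l m => by
      simp only [Matrix.smul_apply, Matrix.sum_apply, Matrix.vecMulVec_apply, smul_eq_mul]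
      exact (Finset.measurable_sum _ fun i _ => (((hX.measurable n).N i (j n)).const_div 1).mul
        (((hX.measurable n).R i l).mul ((hX.measurable n).factorErr i (j n) i m))).const_mul _)
    hC.moment_RFE hr
  have t2 := tendsto_mul_norm_inProb_zero (μ := μ)
    (f := fun n ω => (WithLp.toLp 2 (√((X n).b * (X n).T / (X n).a : ℝ) •
      ∑ i, ((1 / (X n).N i (j n) ω) * (X n).centeredErr μ ω i (j n)) • (X n).R ω i) :
      EuclideanSpace ℝ (Fin k))) ENNReal.coe_ne_top
    (fun n => (measurable_toLp_of_entries fun m => by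
      simp only [Pi.smul_apply, Finset.sum_apply, smul_eq_mul]
      exact (Finset.measurable_sum _ fun i _ => ((((hX.measurable n).N i (j n)).const_div 1).mul
        ((hX.measurable n).centeredErr μ i (j n))).mul ((hX.measurable n).R i m)).const_mul _).norm)
    hC.moment_REE hr
  have t3 := (hrate.mul_const ((M : ℝ) * M)).comp (tendsto_fst_inProb (μ := μ))
  have t := ((t1.mul_const (M : ℝ)).add t2).add t3
  simp only [zero_mul, add_zero] at t
  refine squeeze_zero_norm' ?_ t
  filter_upwards [h.eventually_good hX] with p ⟨hb, ha, _, hR⟩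
  obtain ⟨τ, hτ, hτ2⟩ := h.exists_meanErr_l1_bound p.1 hb
  rw [(X p.1).resid_column_decomp μ, Real.norm_eq_abs]
  set B := √((X p.1).b * (X p.1).T / (X p.1).a : ℝ) • ∑ i, (1 / (X p.1).N i (j p.1) p.2) •
      Matrix.vecMulVec ((X p.1).R p.2 i) ((X p.1).factorErr p.2 i (j p.1) i) with hB
  set g := √((X p.1).b * (X p.1).T / (X p.1).a : ℝ) •
      ∑ i, ((1 / (X p.1).N i (j p.1) p.2) * (X p.1).centeredErr μ p.2 i (j p.1)) • (X p.1).R p.2 i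
  have b1 : |(B *ᵥ (X p.1).R p.2 (j p.1)) m| ≤ ‖B‖ * M := by
    refine (abs_apply_le_norm_toLp _ m).trans ((B.l2_opNorm_mulVec
      (WithLp.toLp 2 ((X p.1).R p.2 (j p.1)))).trans ?_)
    gcongr
    exact hR _
  have b2 := abs_apply_le_norm_toLp g m
  have b3 : |∑ i, (X p.1).meanErr μ p.2 i (j p.1) * (X p.1).R p.2 i m| ≤ M * M := by
    refine (Finset.abs_sum_le_sum_abs _ _).trans ?_
    calc _ ≤ ∑ i, τ i (j p.1) * M := by
          refine Finset.sum_le_sum fun i _ => ?_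
          rw [abs_mul]
          exact mul_le_mul (hτ p.2 i _) ((abs_apply_le_norm_toLp _ m).trans (hR i)) (abs_nonneg _)
            ((abs_nonneg _).trans (hτ p.2 i _))
      _ ≤ _ := by
          rw [← Finset.sum_mul]
          gcongr
          exact hτ2 _
  have hsum : ∀ x₁ x₂ y₁ y₂ y₃ : ℝ, x₁ + x₂ + y₁ + y₂ + y₃ - (x₁ + x₂) = y₁ + y₂ + y₃ := by
    intros
    ring
  rw [hsum]
  have hra : (0 : ℝ) ≤ 1 / √((X p.1).a : ℝ) := by positivity
  have hrb : (0 : ℝ) ≤ √((X p.1).b * (X p.1).T : ℝ) / (X p.1).a := by positivity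
  refine (abs_add_three _ _ _).trans ?_
  rw [abs_mul, abs_mul, abs_mul, abs_of_nonneg hra, abs_of_nonneg hrb]
  simp only [Function.comp_apply]
  have c1 := mul_le_mul_of_nonneg_left b1 hra
  have c2 := mul_le_mul_of_nonneg_left b2 hra
  have c3 := mul_le_mul_of_nonneg_left b3 hrb
  rw [← mul_assoc] at c1
  exact add_le_add_three c1 c2 c3

/-- The second-order part of the expansion, the product of the residual with the estimation error
itself, is negligible: both factors are of order `1 / √(b T) + 1 / √a` in mean square. -/
theorem tendsto_resid_err (h : RowAssumptions X μ M q SigR SigFC)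
    (hX : IsRegularSequence X) (hq : 0 < q) (hQ : IsLimitRotation SigR SigFC d Q)
    (hE : IsAlignedEstimator X μ Q Rhat)
    (hrate : Tendsto (fun n => √((X n).b * (X n).T : ℝ) / (X n).a) atTop (𝓝 0)) (l : Fin k) :
    Tendsto (fun p : ℕ × Ω => √((X p.1).b * (X p.1).T : ℝ) * ((1 / ((X p.1).a : ℝ)) *
        ∑ i, (X p.1).resid p.2 i (j p.1) * (X p.1).err p.2 (Rhat p.1 p.2) i l))
      (inProb μ) (𝓝 0) := by
  obtain ⟨c, hc, hcv⟩ := h.exists_eventually_le_eigval hX hq hQ hE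
  have hs₁ : Tendsto (fun n => √((X n).b * (X n).T : ℝ) / ((X n).b * (X n).T)) atTop (𝓝 0) := by
    simp only [Real.sqrt_div_self']
    simp only [one_div]
    exact (Real.tendsto_sqrt_atTop.comp hX.tendsto_bT).inv_tendsto_atTop
  have t1 := h.tendsto_mul_colSqResid hX hq j (s := fun n => √((X n).b * (X n).T : ℝ))
    (fun n => Real.sqrt_nonneg _) hs₁ hrate
  have t2 := h.tendsto_mul_meanSqResid hX hq (s := fun n => √((X n).b * (X n).T : ℝ))
    (fun n => Real.sqrt_nonneg _) hs₁ hrate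
  have t := t1.mul (((h.tendsto_inv_eigval hX hq hQ hE l).pow 2).mul t2)
  rw [zero_mul] at t
  refine tendsto_zero_of_sq_le ?_ t
  filter_upwards [hcv, eventually_inProb_of_ae hE.isEstimator] with p hv hest
  have hv0 : ∀ l, (X p.1).eigval p.2 l ≠ 0 := fun l => (hc.trans_le (hv l)).ne'
  have h1 := Finset.sum_mul_sq_le_sq_mul_sq Finset.univ
    (fun i => (X p.1).resid p.2 i (j p.1)) fun i => (X p.1).err p.2 (Rhat p.1 p.2) i l
  have h2 := hest.sum_err_sq_le hv0 l
  set s := √((X p.1).b * (X p.1).T : ℝ)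
  calc _ = s ^ 2 * (1 / ((X p.1).a : ℝ)) ^ 2 * (∑ i, (X p.1).resid p.2 i (j p.1) *
        (X p.1).err p.2 (Rhat p.1 p.2) i l) ^ 2 := by ring
    _ ≤ s ^ 2 * (1 / ((X p.1).a : ℝ)) ^ 2 * ((∑ i, (X p.1).resid p.2 i (j p.1) ^ 2) *
        ∑ i, (X p.1).err p.2 (Rhat p.1 p.2) i l ^ 2) := by gcongr
    _ = s ^ 2 * (X p.1).colSqResid p.2 (j p.1) * ((1 / ((X p.1).a : ℝ)) *
        ∑ i, (X p.1).err p.2 (Rhat p.1 p.2) i l ^ 2) := by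
        rw [Panel.colSqResid]
        ring
    _ ≤ s ^ 2 * (X p.1).colSqResid p.2 (j p.1) * (((X p.1).eigval p.2 l)⁻¹ ^ 2 *
        (X p.1).meanSqResid p.2) := by
        have := (X p.1).colSqResid_nonneg p.2 (j p.1)
        gcongr
    _ = _ := by ring

/-- Asymptotic normality of one estimated loading vector. -/
theorem tendstoInDistribution_err (h : RowAssumptions X μ M q SigR SigFC)
    (hX : IsRegularSequence X) (hq : 0 < q) (hQ : IsLimitRotation SigR SigFC d Q)
    (hE : IsAlignedEstimator X μ Q Rhat) (hC : RowCLT X μ M j Gobs Gmiss)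
    (hrate : Tendsto (fun n => √((X n).b * (X n).T : ℝ) / (X n).a) atTop (𝓝 0)) :
    TendstoInDistribution
      (fun n ω => √((X n).b * (X n).T : ℝ) • (X n).err ω (Rhat n ω) (j n))
      atTop id (fun _ => μ)
      (multivariateGaussian (0 : EuclideanSpace ℝ (Fin k))
        ((Matrix.diagonal d)⁻¹ * (Q⁻¹)ᵀ * (Gobs + Gmiss) * Q⁻¹ * (Matrix.diagonal d)⁻¹)) := by
  have hH := h.tendsto_H hX hq hQ hE
  have hv := h.tendsto_inv_eigval hX hq hQ hE
  have hHlm : ∀ m l, Tendsto (fun p : ℕ × Ω => (X p.1).H p.2 (Rhat p.1 p.2) m l) (inProb μ)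
      (𝓝 (Q⁻¹ m l)) := fun m l => tendsto_pi_nhds.1 (tendsto_pi_nhds.1 hH m) l
  have hmH := fun n => (hX.measurable n).aemeasurable_H (hE.measurable n) (hE.isEstimator n)
  have hmv := fun n => (hX.measurable n).aemeasurable_eigval (hE.measurable n) (hE.isEstimator n)
  -- the random coefficient matrix `V⁻¹ Hᵀ` of the leading terms, and its limit
  let G : ℕ → Ω → Fin k → Fin k → ℝ := fun n ω l m =>
    ((X n).eigval ω l)⁻¹ * (X n).H ω (Rhat n ω) m l
  let G₀ : Fin k → Fin k → ℝ := fun l m => (d l)⁻¹ * Q⁻¹ m l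
  have hG : TendstoInMeasure μ G atTop fun _ => G₀ := by
    rw [tendstoInMeasure_const_iff]
    exact tendsto_pi_nhds.2 fun l => tendsto_pi_nhds.2 fun m => (hv l).mul (hHlm m l)
  have hGm : ∀ n, AEMeasurable (G n) μ := fun n =>
    aemeasurable_pi_lambda _ fun l => aemeasurable_pi_lambda _ fun m =>
      (hmv n l).inv.mul (hmH n m l)
  let f : (EuclideanSpace ℝ (Fin k) × EuclideanSpace ℝ (Fin k)) × (Fin k → Fin k → ℝ) →
      EuclideanSpace ℝ (Fin k) := fun z =>
    WithLp.toLp 2 ((Matrix.of z.2) *ᵥ (z.1.1 + z.1.2).ofLp)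
  have hf : Continuous f := by
    refine (PiLp.continuous_toLp 2 _).comp (continuous_pi fun l => ?_)
    simp only [Matrix.mulVec, dotProduct, Matrix.of_apply]
    fun_prop
  have hslutsky := hC.clt.continuous_comp_prodMk_of_tendstoInMeasure_const hf hG hGm
  have hlaw : ((multivariateGaussian (0 : EuclideanSpace ℝ (Fin k)) Gobs).prod
      (multivariateGaussian (0 : EuclideanSpace ℝ (Fin k)) Gmiss)).map
        (fun z => f (id z, G₀)) =
      (multivariateGaussian (0 : EuclideanSpace ℝ (Fin k))
        ((Matrix.diagonal d)⁻¹ * (Q⁻¹)ᵀ * (Gobs + Gmiss) * Q⁻¹ * (Matrix.diagonal d)⁻¹)).map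
        id := by
    have hG₀ : Matrix.of G₀ = (Matrix.diagonal d)⁻¹ * (Q⁻¹)ᵀ := by
      have hinv : (Matrix.diagonal d)⁻¹ = Matrix.diagonal fun l => (d l)⁻¹ := by
        refine Matrix.inv_eq_left_inv ?_
        rw [Matrix.diagonal_mul_diagonal]
        simp [(hQ.pos _).ne']
      ext l m
      rw [hinv, Matrix.diagonal_mul]
      rfl
    have hG₀t : (Matrix.of G₀)ᵀ = Q⁻¹ * (Matrix.diagonal d)⁻¹ := by
      rw [hG₀, Matrix.transpose_mul, Matrix.transpose_transpose, Matrix.transpose_nonsing_inv,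
        Matrix.diagonal_transpose]
    rw [Measure.map_id]
    refine (map_prod_multivariateGaussian hC.posSemidef_obs hC.posSemidef_miss
      (Matrix.of G₀)).trans ?_
    rw [hG₀t, hG₀, ← mul_assoc]
  have hlim : TendstoInDistribution
      (fun n ω => f (((X n).obsTerm ω (j n), (X n).missTerm ω (j n)), G n ω))
      atTop id (fun _ => μ)
      (multivariateGaussian (0 : EuclideanSpace ℝ (Fin k))
        ((Matrix.diagonal d)⁻¹ * (Q⁻¹)ᵀ * (Gobs + Gmiss) * Q⁻¹ * (Matrix.diagonal d)⁻¹)) := by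
    refine ⟨hslutsky.forall_aemeasurable, aemeasurable_id, ?_⟩
    have h1 := hslutsky.tendsto
    simp only [hlaw] at h1
    exact h1
  refine tendstoInDistribution_of_tendstoInMeasure_sub _ _ hlim ?_ fun n =>
    ((hX.measurable n).aemeasurable_err (hE.measurable n) (hE.isEstimator n) (j n)).const_smul
      (√((X n).b * (X n).T : ℝ))
  refine tendstoInMeasure_const_iff.2 ?_
  have hcoord : ∀ l, Tendsto (fun p : ℕ × Ω =>
      (√((X p.1).b * (X p.1).T : ℝ) • (X p.1).err p.2 (Rhat p.1 p.2) (j p.1) -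
        f (((X p.1).obsTerm p.2 (j p.1), (X p.1).missTerm p.2 (j p.1)), G p.1 p.2)).ofLp l)
      (inProb μ) (𝓝 0) := by
    intro l
    obtain ⟨c, hc, hcv⟩ := h.exists_eventually_le_eigval hX hq hQ hE
    have t1 := tendsto_finsetSum Finset.univ fun m (_ : m ∈ Finset.univ) =>
      (hHlm m l).mul (h.tendsto_resid_column hX hC hrate m)
    have t := (hv l).mul (t1.add (h.tendsto_resid_err (j := j) hX hq hQ hE hrate l))
    simp only [mul_zero, Finset.sum_const_zero, add_zero] at t
    refine t.congr' ?_
    filter_upwards [hcv, eventually_inProb_of_ae hE.isEstimator] with p hp hest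
    have hv0 : ∀ l, (X p.1).eigval p.2 l ≠ 0 := fun l => (hc.trans_le (hp l)).ne'
    rw [WithLp.ofLp_sub, Pi.sub_apply, WithLp.ofLp_smul, Pi.smul_apply,
      hest.err_expansion hv0 (j p.1) l]
    simp only [f, G, Matrix.mulVec, dotProduct, Matrix.of_apply, WithLp.ofLp_add, Pi.add_apply,
      smul_eq_mul, mul_sub, Finset.sum_sub_distrib]
    simp only [mul_assoc, ← Finset.mul_sum]
    have h5 : ∀ m, (X p.1).H p.2 (Rhat p.1 p.2) m l * (√((X p.1).b * (X p.1).T : ℝ) *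
          ((1 / ((X p.1).a : ℝ)) * ∑ i, (X p.1).resid p.2 i (j p.1) * (X p.1).R p.2 i m)) =
        √((X p.1).b * (X p.1).T : ℝ) * ((X p.1).H p.2 (Rhat p.1 p.2) m l *
          ((1 / ((X p.1).a : ℝ)) * ∑ i, (X p.1).resid p.2 i (j p.1) * (X p.1).R p.2 i m)) :=
      fun m => mul_left_comm _ _ _
    simp only [h5, ← Finset.mul_sum]
    ring
  exact ((PiLp.continuous_toLp 2 (fun _ : Fin k => ℝ)).tendsto 0).comp (tendsto_pi_nhds.2 hcoord)

/-- The consistency and limit distribution statements for the row loadings. -/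
theorem limit_theory (h : RowAssumptions X μ M q SigR SigFC)
    (hX : IsRegularSequence X) (hq : 0 < q) (hQ : IsLimitRotation SigR SigFC d Q)
    (hE : IsAlignedEstimator X μ Q Rhat) :
    TendstoInMeasure μ (fun n ω => (X n).eigval ω) atTop (fun _ => d) ∧
    TendstoInMeasure μ (fun n ω => (X n).H ω (Rhat n ω)) atTop (fun _ => Q⁻¹) ∧
    ∀ (j : ∀ n, Fin (X n).a) (Gobs Gmiss : Matrix (Fin k) (Fin k) ℝ),
      RowCLT X μ M j Gobs Gmiss →
      Tendsto (fun n => √((X n).b * (X n).T : ℝ) / (X n).a) atTop (𝓝 0) →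
      TendstoInDistribution
        (fun n ω => √((X n).b * (X n).T : ℝ) • (X n).err ω (Rhat n ω) (j n))
        atTop id (fun _ => μ)
        (multivariateGaussian (0 : EuclideanSpace ℝ (Fin k))
          ((Matrix.diagonal d)⁻¹ * (Q⁻¹)ᵀ * (Gobs + Gmiss) * Q⁻¹ * (Matrix.diagonal d)⁻¹)) :=
  ⟨tendstoInMeasure_const_iff.2 (h.tendsto_eigval hX hq hQ hE),
    (tendstoInMeasure_const_iff (E := Matrix (Fin k) (Fin k) ℝ)
      (f := fun n ω => (X n).H ω (Rhat n ω)) (c := Q⁻¹)).2 (h.tendsto_H hX hq hQ hE),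
    fun _ _ _ hC hrate => h.tendstoInDistribution_err hX hq hQ hE hC hrate⟩

end RowAssumptions

theorem theorem3 {Ω : Type*} [MeasurableSpace Ω] (μ : Measure Ω) [IsProbabilityMeasure μ]
    {k r : ℕ} (X : ℕ → Panel Ω k r) (M : ℝ≥0) (hX : ModelAssumptions X μ M)
    (q : ℝ) (hq : 0 < q) :
    -- row loadings
    (∀ (SigR SigFC : Matrix (Fin k) (Fin k) ℝ) (d : Fin k → ℝ) (Q : Matrix (Fin k) (Fin k) ℝ)
        (Rhat : ∀ n, Ω → Matrix (Fin (X n).a) (Fin k) ℝ),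
      RowAssumptions X μ M q SigR SigFC →
      IsLimitRotation SigR SigFC d Q →
      IsAlignedEstimator X μ Q Rhat →
      TendstoInMeasure μ (fun n ω => (X n).eigval ω) atTop (fun _ => d) ∧
      TendstoInMeasure μ (fun n ω => (X n).H ω (Rhat n ω)) atTop (fun _ => Q⁻¹) ∧
      ∀ (j : ∀ n, Fin (X n).a) (Gobs Gmiss : Matrix (Fin k) (Fin k) ℝ),
        RowCLT X μ M j Gobs Gmiss →
        Tendsto (fun n => √((X n).b * (X n).T : ℝ) / (X n).a) atTop (𝓝 0) →
        TendstoInDistribution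
          (fun n ω => √((X n).b * (X n).T : ℝ) • (X n).err ω (Rhat n ω) (j n))
          atTop id (fun _ => μ)
          (multivariateGaussian (0 : EuclideanSpace ℝ (Fin k))
            ((Matrix.diagonal d)⁻¹ * (Q⁻¹)ᵀ * (Gobs + Gmiss) * Q⁻¹ * (Matrix.diagonal d)⁻¹))) ∧
    -- column loadings
    (∀ (SigC SigFR : Matrix (Fin r) (Fin r) ℝ) (e : Fin r → ℝ) (P : Matrix (Fin r) (Fin r) ℝ)
        (Chat : ∀ n, Ω → Matrix (Fin (X n).b) (Fin r) ℝ),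
      RowAssumptions (fun n => (X n).transpose) μ M q SigC SigFR →
      IsLimitRotation SigC SigFR e P →
      IsAlignedEstimator (fun n => (X n).transpose) μ P Chat →
      TendstoInMeasure μ (fun n ω => (X n).transpose.eigval ω) atTop (fun _ => e) ∧
      TendstoInMeasure μ (fun n ω => (X n).transpose.H ω (Chat n ω)) atTop (fun _ => P⁻¹) ∧
      ∀ (j : ∀ n, Fin (X n).b) (Gobs Gmiss : Matrix (Fin r) (Fin r) ℝ),
        RowCLT (fun n => (X n).transpose) μ M j Gobs Gmiss →
        Tendsto (fun n => √((X n).a * (X n).T : ℝ) / (X n).b) atTop (𝓝 0) →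
        TendstoInDistribution
          (fun n ω => √((X n).a * (X n).T : ℝ) • (X n).transpose.err ω (Chat n ω) (j n))
          atTop id (fun _ => μ)
          (multivariateGaussian (0 : EuclideanSpace ℝ (Fin r))
            ((Matrix.diagonal e)⁻¹ * (P⁻¹)ᵀ * (Gobs + Gmiss) * P⁻¹ * (Matrix.diagonal e)⁻¹))) := by
  exact ⟨fun _ _ _ _ _ h hQ hE => h.limit_theory hX.isRegularSequence hq hQ hE,
    fun _ _ _ _ _ h hQ hE => h.limit_theory hX.isRegularSequence.transpose hq hQ hE⟩
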